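/- A category is called semi-abelian if it has a zero object, is exact in the sense of Barr (it is finitely complete, has coequalizers of kernel pairs, its regular epimorphisms are stable under pullback, and every internal equivalence relation is the kernel pair of some morphism), is protomodular in the sense of Bourn (for every morphism $f\colon E\to B$ the change-of-base functor $f^*\colon \mathrm{Pt}(B)\to\mathrm{Pt}(E)$ between the categories of split epimorphisms with a chosen section over $B$ and over $E$ reflects isomorphisms), and has binary coproducts. For a finitely complete category $\mathscr{C}$, let $\mathrm{Grpd}(\mathscr{C})$ be the category of internal groupoids and internal functors in $\mathscr{C}$, and let $\mathrm{Grpd}^2(\mathscr{C})=\mathrm{Grpd}(\mathrm{Grpd}(\mathscr{C}))$ be the category of internal double groupoids in $\mathscr{C}$. Let $2\text{-}\mathrm{Grpd}(\mathscr{C})$ be the full subcategory of $\mathrm{Grpd}^2(\mathscr{C})$ whose objects are the internal $2$-groupoids, i.e. the double groupoids $\mathbb{C}$ whose internal groupoid of objects $C^0_1\rightrightarrows C^0_0$ is discrete, meaning that its identity morphism $e^0\colon C^0_0\to C^0_1$ is an isomorphism. Corollary. If $\mathscr{C}$ is a semi-abelian category, then $2\text{-}\mathrm{Grpd}(\mathscr{C})$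 is a semi-abelian category. -/

import Mathlib

open CategoryTheory CategoryTheory.Limits

universe v u

namespace CategoryTheory

/-! ### Semi-abelian categories -/

section SemiAbelian

variable (C : Type u) [Category.{v} C]

/-- A (Barr-)exact category: a regular category in which every internal equivalence relation is
effective, i.e. is the kernel pair of some morphism. -/
class BarrExact : Prop extends Regular C where
  effective : ∀ {R X : C} (p₁ p₂ : R ⟶ X), IsEquivalenceRelation p₁ p₂ →
    ∃ (Y : C) (f : X ⟶ Y), IsKernelPair f p₁ p₂

/-- A protomodular category in the sense of Bourn: for every morphism `f : E ⟶ B`, the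
change-of-base functor `f^* : Pt(B) ⥤ Pt(E)` between categories of points (split epimorphisms with
a chosen section) reflects isomorphisms. Explicitly: let `b` be a morphism from the point
`(p, s)` to the point `(p', s')` over `B`, and let `a` be the induced morphism between the pullbacks
along `f`; if `a` is an isomorphism, then so is `b`. (The sections of the pulled back points are
determined by those of the given ones, and they are automatically preserved by `a`.) -/
class Protomodular : Prop extends HasPullbacks C where
  isIso_of_isIso_pullback :
    ∀ {E B A A' : C} (f : E ⟶ B)
      (p : A ⟶ B) (s : B ⟶ A) (_ : s ≫ p = 𝟙 B)
      (p' : A' ⟶ B) (s' : B ⟶ A') (_ : s' ≫ p' = 𝟙 B)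
      (b : A ⟶ A') (_ : b ≫ p' = p) (_ : s ≫ b = s')
      {P P' : C} (g : P ⟶ A) (q : P ⟶ E) (_ : IsPullback g q p f)
      (g' : P' ⟶ A') (q' : P' ⟶ E) (_ : IsPullback g' q' p' f)
      (a : P ⟶ P') (_ : a ≫ g' = g ≫ b) (_ : a ≫ q' = q),
      IsIso a → IsIso b

/-- A semi-abelian category: pointed (it has a zero object), exact, protomodular, and with binary
coproducts. -/
class SemiAbelian : Prop extends HasZeroObject C, BarrExact C, Protomodular C,
  HasBinaryCoproducts C

end SemiAbelian

/-! ### Internal categories and groupoids -/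

section Internal

/-- An internal reflexive graph, with domain `d`, codomain `c` and identities `e`. -/
structure ReflexiveGraph (C : Type u) [Category.{v} C] where
  X₀ : C
  X₁ : C
  d : X₁ ⟶ X₀
  c : X₁ ⟶ X₀
  e : X₀ ⟶ X₁
  e_d : e ≫ d = 𝟙 X₀
  e_c : e ≫ c = 𝟙 X₀

/-- An internal category. The composition `m` is written in diagrammatic order: `(f, g)` with
`c f = d g` is sent to a morphism from `d f` to `c g`. Associativity is expressed on
generalized elements. -/
structure InternalCategory (C : Type u) [Category.{v} C] [HasPullbacks C] extends
    ReflexiveGraph C where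
  m : pullback c d ⟶ X₁
  m_d : m ≫ d = pullback.fst c d ≫ d
  m_c : m ≫ c = pullback.snd c d ≫ c
  id_m : pullback.lift (d ≫ e) (𝟙 X₁)
    (by rw [Category.assoc, e_c, Category.comp_id, Category.id_comp]) ≫ m = 𝟙 X₁
  m_id : pullback.lift (𝟙 X₁) (c ≫ e)
    (by rw [Category.assoc, e_d, Category.comp_id, Category.id_comp]) ≫ m = 𝟙 X₁
  assoc : ∀ {T : C} (f g h : T ⟶ X₁) (hfg : f ≫ c = g ≫ d) (hgh : g ≫ c = h ≫ d),
    pullback.lift (pullback.lift f g hfg ≫ m) h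
        (by rw [Category.assoc, m_c, pullback.lift_snd_assoc, hgh]) ≫ m =
      pullback.lift f (pullback.lift g h hgh ≫ m)
        (by rw [Category.assoc, m_d, pullback.lift_fst_assoc, hfg]) ≫ m

/-- An internal groupoid: an internal category with an inversion `i` (which is unique). -/
structure InternalGroupoid (C : Type u) [Category.{v} C] [HasPullbacks C] extends
    InternalCategory C where
  i : X₁ ⟶ X₁
  i_d : i ≫ d = c
  i_c : i ≫ c = d
  m_i : pullback.lift (𝟙 X₁) i (by rw [i_d, Category.id_comp]) ≫ m = d ≫ e
  i_m : pullback.lift i (𝟙 X₁) (by rw [i_c, Category.id_comp]) ≫ m = c ≫ e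

variable {C : Type u} [Category.{v} C] [HasPullbacks C]

/-- An internal functor between internal categories. -/
@[ext]
structure InternalFunctor (X Y : InternalCategory C) where
  f₀ : X.X₀ ⟶ Y.X₀
  f₁ : X.X₁ ⟶ Y.X₁
  w_d : f₁ ≫ Y.d = X.d ≫ f₀
  w_c : f₁ ≫ Y.c = X.c ≫ f₀
  w_e : X.e ≫ f₁ = f₀ ≫ Y.e
  w_m : X.m ≫ f₁ = pullback.lift (pullback.fst X.c X.d ≫ f₁) (pullback.snd X.c X.d ≫ f₁)
    (by rw [Category.assoc, Category.assoc, w_c, w_d, pullback.condition_assoc]) ≫ Y.m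

namespace InternalFunctor

/-- The identity internal functor. -/
@[simps]
def id (X : InternalCategory C) : InternalFunctor X X where
  f₀ := 𝟙 _
  f₁ := 𝟙 _
  w_d := by simp
  w_c := by simp
  w_e := by simp
  w_m := by
    have : pullback.lift (pullback.fst X.c X.d ≫ 𝟙 X.X₁) (pullback.snd X.c X.d ≫ 𝟙 X.X₁)
        (by simp [pullback.condition]) = 𝟙 (pullback X.c X.d) := by
      apply pullback.hom_ext <;> simp
    rw [this]; simp

/-- An internal functor preserves the composition of generalized elements. -/
lemma lift_m {X Y : InternalCategory C} (F : InternalFunctor X Y) {T : C} (f g : T ⟶ X.X₁)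
    (h : f ≫ X.c = g ≫ X.d) (h' : (f ≫ F.f₁) ≫ Y.c = (g ≫ F.f₁) ≫ Y.d) :
    pullback.lift f g h ≫ X.m ≫ F.f₁ = pullback.lift (f ≫ F.f₁) (g ≫ F.f₁) h' ≫ Y.m := by
  rw [F.w_m, ← Category.assoc]
  congr 1
  apply pullback.hom_ext
  · rw [Category.assoc, pullback.lift_fst, pullback.lift_fst_assoc, pullback.lift_fst]
  · rw [Category.assoc, pullback.lift_snd, pullback.lift_snd_assoc, pullback.lift_snd]

/-- Composition of internal functors. -/
@[simps]
def comp {X Y Z : InternalCategory C} (F : InternalFunctor X Y) (G : InternalFunctor Y Z) :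
    InternalFunctor X Z where
  f₀ := F.f₀ ≫ G.f₀
  f₁ := F.f₁ ≫ G.f₁
  w_d := by rw [Category.assoc, G.w_d, ← Category.assoc, F.w_d, Category.assoc]
  w_c := by rw [Category.assoc, G.w_c, ← Category.assoc, F.w_c, Category.assoc]
  w_e := by rw [← Category.assoc, F.w_e, Category.assoc, G.w_e, Category.assoc]
  w_m := by
    rw [← Category.assoc, F.w_m, Category.assoc, G.lift_m]
    · simp only [Category.assoc]
    · simp only [Category.assoc, G.w_c, G.w_d]
      rw [reassoc_of% F.w_c, reassoc_of% F.w_d, pullback.condition_assoc]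

end InternalFunctor

/-- The category of internal groupoids and internal functors. -/
instance InternalGroupoid.category : Category.{v} (InternalGroupoid C) where
  Hom X Y := InternalFunctor X.toInternalCategory Y.toInternalCategory
  id X := InternalFunctor.id X.toInternalCategory
  comp F G := InternalFunctor.comp F G
  id_comp F := by apply InternalFunctor.ext <;> simp
  comp_id F := by apply InternalFunctor.ext <;> simp
  assoc F G H := by apply InternalFunctor.ext <;> simp

namespace InternalGroupoid

@[ext]
lemma hom_ext {X Y : InternalGroupoid C} {F G : X ⟶ Y} (h₀ : F.f₀ = G.f₀) (h₁ : F.f₁ = G.f₁) :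
    F = G :=
  InternalFunctor.ext h₀ h₁

@[simp] lemma id_f₀ (X : InternalGroupoid C) : InternalFunctor.f₀ (𝟙 X) = 𝟙 X.X₀ := rfl
@[simp] lemma id_f₁ (X : InternalGroupoid C) : InternalFunctor.f₁ (𝟙 X) = 𝟙 X.X₁ := rfl
@[simp] lemma comp_f₀ {X Y Z : InternalGroupoid C} (F : X ⟶ Y) (G : Y ⟶ Z) :
    (F ≫ G).f₀ = F.f₀ ≫ G.f₀ := rfl
@[simp] lemma comp_f₁ {X Y Z : InternalGroupoid C} (F : X ⟶ Y) (G : Y ⟶ Z) :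
    (F ≫ G).f₁ = F.f₁ ≫ G.f₁ := rfl

/-! Pullbacks of internal groupoids, computed levelwise. They are needed in order to consider
internal groupoids in the category of internal groupoids. -/

section Pullbacks

variable {X Y Z : InternalGroupoid C} (F : X ⟶ Z) (G : Y ⟶ Z)

/-- The levelwise pullback of internal groupoids: the underlying reflexive graph. -/
noncomputable abbrev pullbackGraph : ReflexiveGraph C where
  X₀ := pullback F.f₀ G.f₀
  X₁ := pullback F.f₁ G.f₁
  d := pullback.lift (pullback.fst F.f₁ G.f₁ ≫ X.d) (pullback.snd F.f₁ G.f₁ ≫ Y.d)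
    (by rw [Category.assoc, Category.assoc, ← F.w_d, ← G.w_d, pullback.condition_assoc])
  c := pullback.lift (pullback.fst F.f₁ G.f₁ ≫ X.c) (pullback.snd F.f₁ G.f₁ ≫ Y.c)
    (by rw [Category.assoc, Category.assoc, ← F.w_c, ← G.w_c, pullback.condition_assoc])
  e := pullback.lift (pullback.fst F.f₀ G.f₀ ≫ X.e) (pullback.snd F.f₀ G.f₀ ≫ Y.e)
    (by rw [Category.assoc, Category.assoc, F.w_e, G.w_e, pullback.condition_assoc])
  e_d := by
    apply pullback.hom_ext <;>
      simp only [Category.assoc, Category.id_comp, Category.comp_id, pullback.lift_fst,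
        pullback.lift_snd, pullback.lift_fst_assoc, pullback.lift_snd_assoc, X.e_d, Y.e_d]
  e_c := by
    apply pullback.hom_ext <;>
      simp only [Category.assoc, Category.id_comp, Category.comp_id, pullback.lift_fst,
        pullback.lift_snd, pullback.lift_fst_assoc, pullback.lift_snd_assoc, X.e_c, Y.e_c]

lemma lift_m_congr (X : InternalCategory C) {T : C} {f f' g g' : T ⟶ X.X₁} (hf : f = f')
    (hg : g = g') (h : f ≫ X.c = g ≫ X.d) (h' : f' ≫ X.c = g' ≫ X.d) :
    pullback.lift f g h ≫ X.m = pullback.lift f' g' h' ≫ X.m := by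
  subst hf hg
  rfl

lemma comp_lift_m (X : InternalCategory C) {S T : C} (k : S ⟶ T) (f g : T ⟶ X.X₁)
    (h : f ≫ X.c = g ≫ X.d) :
    k ≫ pullback.lift f g h ≫ X.m = pullback.lift (k ≫ f) (k ≫ g)
      (by rw [Category.assoc, Category.assoc, h]) ≫ X.m := by
  rw [← Category.assoc]
  congr 1
  apply pullback.hom_ext <;>
    simp only [Category.assoc, pullback.lift_fst, pullback.lift_snd]

variable {F G} in
lemma pullbackGraph_fst {T : C} {f g : T ⟶ (pullbackGraph F G).X₁}
    (h : f ≫ (pullbackGraph F G).c = g ≫ (pullbackGraph F G).d) :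
    (f ≫ pullback.fst F.f₁ G.f₁) ≫ X.c = (g ≫ pullback.fst F.f₁ G.f₁) ≫ X.d := by
  have := h =≫ pullback.fst F.f₀ G.f₀
  simpa only [Category.assoc, pullback.lift_fst] using this

variable {F G} in
lemma pullbackGraph_snd {T : C} {f g : T ⟶ (pullbackGraph F G).X₁}
    (h : f ≫ (pullbackGraph F G).c = g ≫ (pullbackGraph F G).d) :
    (f ≫ pullback.snd F.f₁ G.f₁) ≫ Y.c = (g ≫ pullback.snd F.f₁ G.f₁) ≫ Y.d := by
  have := h =≫ pullback.snd F.f₀ G.f₀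
  simpa only [Category.assoc, pullback.lift_snd] using this

/-- The levelwise composition. -/
noncomputable def pullbackM :
    pullback (pullbackGraph F G).c (pullbackGraph F G).d ⟶ pullback F.f₁ G.f₁ :=
  pullback.lift
    (pullback.lift _ _ (pullbackGraph_fst pullback.condition) ≫ X.m)
    (pullback.lift _ _ (pullbackGraph_snd pullback.condition) ≫ Y.m)
    (by
      rw [Category.assoc, Category.assoc, F.lift_m, G.lift_m]
      · congr 1
        apply pullback.hom_ext <;>
          simp only [Category.assoc, pullback.lift_fst, pullback.lift_snd, pullback.condition]
      · simp only [Category.assoc, G.w_c, G.w_d]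
        simpa only [Category.assoc] using
          pullbackGraph_snd (F := F) (G := G) pullback.condition =≫ G.f₀
      · simp only [Category.assoc, F.w_c, F.w_d]
        simpa only [Category.assoc] using
          pullbackGraph_fst (F := F) (G := G) pullback.condition =≫ F.f₀)

lemma lift_pullbackM_fst {T : C} (f g : T ⟶ (pullbackGraph F G).X₁)
    (h : f ≫ (pullbackGraph F G).c = g ≫ (pullbackGraph F G).d) :
    pullback.lift f g h ≫ pullbackM F G ≫ pullback.fst F.f₁ G.f₁ =
      pullback.lift (f ≫ pullback.fst F.f₁ G.f₁) (g ≫ pullback.fst F.f₁ G.f₁)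
        (pullbackGraph_fst h) ≫ X.m := by
  simp only [pullbackM, pullback.lift_fst, comp_lift_m, pullback.lift_fst_assoc,
    pullback.lift_snd_assoc]

lemma lift_pullbackM_snd {T : C} (f g : T ⟶ (pullbackGraph F G).X₁)
    (h : f ≫ (pullbackGraph F G).c = g ≫ (pullbackGraph F G).d) :
    pullback.lift f g h ≫ pullbackM F G ≫ pullback.snd F.f₁ G.f₁ =
      pullback.lift (f ≫ pullback.snd F.f₁ G.f₁) (g ≫ pullback.snd F.f₁ G.f₁)
        (pullbackGraph_snd h) ≫ Y.m := by
  simp only [pullbackM, pullback.lift_snd, comp_lift_m, pullback.lift_fst_assoc,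
    pullback.lift_snd_assoc]

lemma lift_m_d (X : InternalCategory C) {T : C} (f g : T ⟶ X.X₁) (h : f ≫ X.c = g ≫ X.d) :
    pullback.lift f g h ≫ X.m ≫ X.d = f ≫ X.d := by
  rw [X.m_d, pullback.lift_fst_assoc]

lemma lift_m_c (X : InternalCategory C) {T : C} (f g : T ⟶ X.X₁) (h : f ≫ X.c = g ≫ X.d) :
    pullback.lift f g h ≫ X.m ≫ X.c = g ≫ X.c := by
  rw [X.m_c, pullback.lift_snd_assoc]

lemma lift_id_m (X : InternalCategory C) {T : C} (f g : T ⟶ X.X₁) (h : f ≫ X.c = g ≫ X.d)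
    (hf : f = g ≫ X.d ≫ X.e) : pullback.lift f g h ≫ X.m = g := by
  subst hf
  have := g ≫= X.id_m
  rw [comp_lift_m] at this
  simpa only [Category.comp_id] using this

lemma lift_m_id (X : InternalCategory C) {T : C} (f g : T ⟶ X.X₁) (h : f ≫ X.c = g ≫ X.d)
    (hg : g = f ≫ X.c ≫ X.e) : pullback.lift f g h ≫ X.m = f := by
  subst hg
  have := f ≫= X.m_id
  rw [comp_lift_m] at this
  simpa only [Category.comp_id] using this

lemma lift_m_i (X : InternalGroupoid C) {T : C} (f g : T ⟶ X.X₁) (h : f ≫ X.c = g ≫ X.d)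
    (hg : g = f ≫ X.i) : pullback.lift f g h ≫ X.m = f ≫ X.d ≫ X.e := by
  subst hg
  have := f ≫= X.m_i
  rw [comp_lift_m] at this
  simpa only [Category.comp_id] using this

lemma lift_i_m (X : InternalGroupoid C) {T : C} (f g : T ⟶ X.X₁) (h : f ≫ X.c = g ≫ X.d)
    (hf : f = g ≫ X.i) : pullback.lift f g h ≫ X.m = g ≫ X.c ≫ X.e := by
  subst hf
  have := g ≫= X.i_m
  rw [comp_lift_m] at this
  simpa only [Category.comp_id] using this

/-- Internal functors between internal groupoids preserve inverses. -/
lemma i_comp {X Z : InternalGroupoid C} (F : X ⟶ Z) : X.i ≫ F.f₁ = F.f₁ ≫ Z.i := by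
  have h₁ : (F.f₁ ≫ Z.i) ≫ Z.c = F.f₁ ≫ Z.d := by rw [Category.assoc, Z.i_c]
  have h₂ : F.f₁ ≫ Z.c = (X.i ≫ F.f₁) ≫ Z.d := by
    rw [Category.assoc, F.w_d, F.w_c, ← Category.assoc, X.i_d]
  have h₃ : pullback.lift F.f₁ (X.i ≫ F.f₁) h₂ ≫ Z.m = F.f₁ ≫ Z.d ≫ Z.e := by
    have := X.m_i =≫ F.f₁
    rw [Category.assoc, F.lift_m _ _ _ (by simpa only [Category.id_comp] using h₂)] at this
    simp only [Category.id_comp] at this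
    rw [this, Category.assoc, F.w_e, reassoc_of% F.w_d]
  have key := Z.assoc (F.f₁ ≫ Z.i) F.f₁ (X.i ≫ F.f₁) h₁ h₂
  simp only [h₃, lift_i_m Z (F.f₁ ≫ Z.i) F.f₁ h₁ rfl] at key
  rw [lift_id_m, lift_m_id] at key
  · exact key
  · rw [Category.assoc, reassoc_of% Z.i_c]
  · rw [← Category.assoc, h₂, Category.assoc]

lemma pullback_m_d : pullbackM F G ≫ (pullbackGraph F G).d =
    pullback.fst (pullbackGraph F G).c (pullbackGraph F G).d ≫ (pullbackGraph F G).d := by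
  apply pullback.hom_ext
  · simp only [pullbackM, Category.assoc, pullback.lift_fst, pullback.lift_fst_assoc, lift_m_d]
  · simp only [pullbackM, Category.assoc, pullback.lift_snd, pullback.lift_snd_assoc, lift_m_d]

lemma pullback_m_c : pullbackM F G ≫ (pullbackGraph F G).c =
    pullback.snd (pullbackGraph F G).c (pullbackGraph F G).d ≫ (pullbackGraph F G).c := by
  apply pullback.hom_ext
  · simp only [pullbackM, Category.assoc, pullback.lift_fst, pullback.lift_fst_assoc, lift_m_c]
  · simp only [pullbackM, Category.assoc, pullback.lift_snd, pullback.lift_snd_assoc, lift_m_c]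

/-- The levelwise pullback of internal groupoids. -/
noncomputable def pullbackGroupoid : InternalGroupoid C where
  toReflexiveGraph := pullbackGraph F G
  m := pullbackM F G
  m_d := pullback_m_d F G
  m_c := pullback_m_c F G
  id_m := by
    apply pullback.hom_ext
    · rw [Category.assoc, lift_pullbackM_fst]
      refine lift_id_m X.toInternalCategory _ _ _ ?_
      simp only [Category.assoc, Category.id_comp, pullback.lift_fst, pullback.lift_fst_assoc]
    · rw [Category.assoc, lift_pullbackM_snd]
      refine lift_id_m Y.toInternalCategory _ _ _ ?_
      simp only [Category.assoc, Category.id_comp, pullback.lift_snd, pullback.lift_snd_assoc]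
  m_id := by
    apply pullback.hom_ext
    · rw [Category.assoc, lift_pullbackM_fst]
      refine lift_m_id X.toInternalCategory _ _ _ ?_
      simp only [Category.assoc, Category.id_comp, pullback.lift_fst, pullback.lift_fst_assoc]
    · rw [Category.assoc, lift_pullbackM_snd]
      refine lift_m_id Y.toInternalCategory _ _ _ ?_
      simp only [Category.assoc, Category.id_comp, pullback.lift_snd, pullback.lift_snd_assoc]
  assoc f g h hfg hgh := by
    apply pullback.hom_ext
    · refine (Category.assoc _ _ _).trans (((lift_pullbackM_fst F G _ _ _).trans ?_).trans
        ((Category.assoc _ _ _).trans (lift_pullbackM_fst F G _ _ _)).symm)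
      exact (lift_m_congr _ ((Category.assoc _ _ _).trans (lift_pullbackM_fst F G _ _ _))
          rfl _ _).trans
        ((X.assoc _ _ _ (pullbackGraph_fst hfg) (pullbackGraph_fst hgh)).trans
          (lift_m_congr _ rfl ((Category.assoc _ _ _).trans (lift_pullbackM_fst F G _ _ _)).symm
            _ _))
    · refine (Category.assoc _ _ _).trans (((lift_pullbackM_snd F G _ _ _).trans ?_).trans
        ((Category.assoc _ _ _).trans (lift_pullbackM_snd F G _ _ _)).symm)
      exact (lift_m_congr _ ((Category.assoc _ _ _).trans (lift_pullbackM_snd F G _ _ _))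
          rfl _ _).trans
        ((Y.assoc _ _ _ (pullbackGraph_snd hfg) (pullbackGraph_snd hgh)).trans
          (lift_m_congr _ rfl ((Category.assoc _ _ _).trans (lift_pullbackM_snd F G _ _ _)).symm
            _ _))
  i := pullback.lift (pullback.fst F.f₁ G.f₁ ≫ X.i) (pullback.snd F.f₁ G.f₁ ≫ Y.i)
    (by rw [Category.assoc, Category.assoc, i_comp, i_comp, pullback.condition_assoc])
  i_d := by
    apply pullback.hom_ext <;>
      simp only [Category.assoc, pullback.lift_fst, pullback.lift_snd, pullback.lift_fst_assoc,
        pullback.lift_snd_assoc, X.i_d, Y.i_d]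
  i_c := by
    apply pullback.hom_ext <;>
      simp only [Category.assoc, pullback.lift_fst, pullback.lift_snd, pullback.lift_fst_assoc,
        pullback.lift_snd_assoc, X.i_c, Y.i_c]
  m_i := by
    apply pullback.hom_ext
    · rw [Category.assoc, lift_pullbackM_fst, lift_m_i]
      · simp only [Category.assoc, Category.id_comp, pullback.lift_fst, pullback.lift_fst_assoc]
      · simp only [Category.id_comp, pullback.lift_fst]
    · rw [Category.assoc, lift_pullbackM_snd, lift_m_i]
      · simp only [Category.assoc, Category.id_comp, pullback.lift_snd, pullback.lift_snd_assoc]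
      · simp only [Category.id_comp, pullback.lift_snd]
  i_m := by
    apply pullback.hom_ext
    · rw [Category.assoc, lift_pullbackM_fst, lift_i_m]
      · simp only [Category.assoc, Category.id_comp, pullback.lift_fst, pullback.lift_fst_assoc]
      · simp only [Category.id_comp, pullback.lift_fst]
    · rw [Category.assoc, lift_pullbackM_snd, lift_i_m]
      · simp only [Category.assoc, Category.id_comp, pullback.lift_snd, pullback.lift_snd_assoc]
      · simp only [Category.id_comp, pullback.lift_snd]

/-- The first projection. -/
noncomputable def pullbackFst : pullbackGroupoid F G ⟶ X where
  f₀ := pullback.fst F.f₀ G.f₀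
  f₁ := pullback.fst F.f₁ G.f₁
  w_d := (pullback.lift_fst _ _ _).symm
  w_c := (pullback.lift_fst _ _ _).symm
  w_e := pullback.lift_fst _ _ _
  w_m := pullback.lift_fst _ _ _

/-- The second projection. -/
noncomputable def pullbackSnd : pullbackGroupoid F G ⟶ Y where
  f₀ := pullback.snd F.f₀ G.f₀
  f₁ := pullback.snd F.f₁ G.f₁
  w_d := (pullback.lift_snd _ _ _).symm
  w_c := (pullback.lift_snd _ _ _).symm
  w_e := pullback.lift_snd _ _ _
  w_m := pullback.lift_snd _ _ _

variable {F G} in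
lemma square_f₀ {W : InternalGroupoid C} {H : W ⟶ X} {K : W ⟶ Y} (h : H ≫ F = K ≫ G) :
    H.f₀ ≫ F.f₀ = K.f₀ ≫ G.f₀ := congrArg InternalFunctor.f₀ h

variable {F G} in
lemma square_f₁ {W : InternalGroupoid C} {H : W ⟶ X} {K : W ⟶ Y} (h : H ≫ F = K ≫ G) :
    H.f₁ ≫ F.f₁ = K.f₁ ≫ G.f₁ := congrArg InternalFunctor.f₁ h

variable {F G} in
/-- The internal functor into the pullback induced by a commutative square. -/
noncomputable def pullbackLift {W : InternalGroupoid C} (H : W ⟶ X) (K : W ⟶ Y)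
    (h : H ≫ F = K ≫ G) : W ⟶ pullbackGroupoid F G where
  f₀ := pullback.lift H.f₀ K.f₀ (square_f₀ h)
  f₁ := pullback.lift H.f₁ K.f₁ (square_f₁ h)
  w_d := by
    apply pullback.hom_ext <;>
      simp only [pullbackGroupoid, Category.assoc, pullback.lift_fst, pullback.lift_snd,
        pullback.lift_fst_assoc, pullback.lift_snd_assoc, H.w_d, K.w_d]
  w_c := by
    apply pullback.hom_ext <;>
      simp only [pullbackGroupoid, Category.assoc, pullback.lift_fst, pullback.lift_snd,
        pullback.lift_fst_assoc, pullback.lift_snd_assoc, H.w_c, K.w_c]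
  w_e := by
    apply pullback.hom_ext <;>
      simp only [pullbackGroupoid, Category.assoc, pullback.lift_fst, pullback.lift_snd,
        pullback.lift_fst_assoc, pullback.lift_snd_assoc, H.w_e, K.w_e]
  w_m := by
    apply pullback.hom_ext
    · simp only [pullbackGroupoid, Category.assoc, pullback.lift_fst, H.w_m]
      refine ((lift_pullbackM_fst F G _ _ _).trans (lift_m_congr _ ?_ ?_ _ _)).symm <;>
        simp only [Category.assoc, pullback.lift_fst]
    · simp only [pullbackGroupoid, Category.assoc, pullback.lift_snd, K.w_m]
      refine ((lift_pullbackM_snd F G _ _ _).trans (lift_m_congr _ ?_ ?_ _ _)).symm <;>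
        simp only [Category.assoc, pullback.lift_snd]

lemma isPullback_pullbackGroupoid :
    IsPullback (pullbackFst F G) (pullbackSnd F G) F G where
  w := by
    ext
    · exact pullback.condition
    · exact pullback.condition
  isLimit' := ⟨PullbackCone.IsLimit.mk _ (fun s => pullbackLift s.fst s.snd s.condition)
    (fun s => by
      ext
      · exact pullback.lift_fst _ _ _
      · exact pullback.lift_fst _ _ _)
    (fun s => by
      ext
      · exact pullback.lift_snd _ _ _
      · exact pullback.lift_snd _ _ _)
    (fun s k h₁ h₂ => by
      ext
      · apply pullback.hom_ext
        · exact (congrArg InternalFunctor.f₀ h₁).trans (pullback.lift_fst _ _ _).symm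
        · exact (congrArg InternalFunctor.f₀ h₂).trans (pullback.lift_snd _ _ _).symm
      · apply pullback.hom_ext
        · exact (congrArg InternalFunctor.f₁ h₁).trans (pullback.lift_fst _ _ _).symm
        · exact (congrArg InternalFunctor.f₁ h₂).trans (pullback.lift_snd _ _ _).symm)⟩

end Pullbacks

instance hasPullbacks : HasPullbacks (InternalGroupoid C) :=
  
  have (X Y Z : InternalGroupoid C) (F : X ⟶ Z) (G : Y ⟶ Z) : HasLimit (cospan F G) :=
    (isPullback_pullbackGroupoid F G).hasPullback
  hasPullbacks_of_hasLimit_cospan _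

end InternalGroupoid

/-! ### Double groupoids and 2-groupoids -/

variable (C)

/-- The category of internal double groupoids: internal groupoids in the category of internal
groupoids. -/
abbrev InternalDoubleGroupoid : Type (max u v) := InternalGroupoid (InternalGroupoid C)

/-- A double groupoid `G` is a 2-groupoid when its internal groupoid of objects `G.X₀` is discrete,
i.e. when the identity morphism `e` of the internal groupoid `G.X₀` is an isomorphism. -/
def isInternalTwoGroupoid : ObjectProperty (InternalDoubleGroupoid C) :=
  fun G => IsIso G.X₀.e

/-- The category of internal 2-groupoids, a full subcategory of that of double groupoids. -/
abbrev InternalTwoGroupoid : Type (max u v) := (isInternalTwoGroupoid C).FullSubcategory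

end Internal

end CategoryTheory

/-! Everything rests on one consequence of protomodularity. For a reflexive graph, the object of
composable pairs is a point over `X₁`, with projection `fst` and section `x ↦ (x, 1)`; pulling it
back along `e` gives the pairs `(1, y)`. Hence `inl : x ↦ (x, 1)` and `inr : y ↦ (1, y)` are jointly
strongly epimorphic (`ReflexiveGraph.isIso_of_mono`, `ReflexiveGraph.hom_ext`). A unital
multiplication is therefore unique, and it is automatically associative, compatible with `d` and
`c`, and invertible. Likewise, every graph morphism between groupoids is a functor. Being a groupoid
is thus a property of a reflexive graph.

This makes the category of groupoids in a semi-abelian category semi-abelian again. Limits and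
isomorphisms are levelwise. The levelwise quotient by an equivalence relation is a graph to which
the multiplication descends, so exactness and protomodularity are inherited from the base
(`ReflectsExactness`). For coproducts, groupoids are reflective in reflexive graphs: the coequalizer
of `inl` and `inr` replaces the object of arrows (`exists_reflection`), and one reflects the
levelwise coproduct. The coequalizers needed come from the Mal'cev property: a reflexive relation is
an equivalence relation, hence effective.

Applying this twice makes double groupoids semi-abelian. The 2-groupoids form a full subcategory
closed under finite limits and regular quotients. It is also reflective with epimorphic units: make
the groupoid of objects discrete by passing to connected components, then push the double groupoid
forward along this map. Such a subcategory is semi-abelian (`SemiAbelian.fullSubcategory`). -/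

namespace CategoryTheory

/-! ### Joint strong epimorphy in protomodular categories -/

section Protomodular

variable {C : Type u} [Category.{v} C] [Protomodular C]

/-- In a protomodular category, the section of a point and the projection of its pullback along any
morphism are jointly strongly epimorphic. -/
lemma Protomodular.isIso_of_mono {E B A P M : C} {f : E ⟶ B} {p : A ⟶ B} {s : B ⟶ A}
    (hs : s ≫ p = 𝟙 B) {g : P ⟶ A} {q : P ⟶ E} (h : IsPullback g q p f) (j : M ⟶ A) [Mono j]
    {g' : P ⟶ M} (hg : g' ≫ j = g) {s' : B ⟶ M} (hs' : s' ≫ j = s) : IsIso j := by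
  -- As `g` factors through the monomorphism `j`, the points on `M` and on `A` have the same
  -- pullback along `f`, and `j` induces the identity on it.
  have h' : IsPullback g' q (j ≫ p) f := by
    refine ⟨⟨by rw [reassoc_of% hg, h.w]⟩, ⟨PullbackCone.IsLimit.mk _
      (fun t => h.lift (t.fst ≫ j) t.snd (by simpa using t.condition)) (fun t => ?_)
      (fun t => h.lift_snd _ _ _) (fun t k h₁ h₂ => h.hom_ext ?_ ?_)⟩⟩
    · rw [← cancel_mono j, Category.assoc, hg, h.lift_fst]
    · rw [h.lift_fst, ← h₁, Category.assoc, hg]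
    · rw [h.lift_snd, h₂]
  exact Protomodular.isIso_of_isIso_pullback f (j ≫ p) s' (by rw [reassoc_of% hs', hs]) p s hs j rfl
    hs' g' q h' g q h (𝟙 P) (by rw [Category.id_comp, hg]) (Category.id_comp _) inferInstance

/-- In a protomodular category, the section of a point and the projection of its pullback along any
morphism are jointly epimorphic. -/
lemma Protomodular.hom_ext [HasEqualizers C] {E B A P Z : C} {f : E ⟶ B} {p : A ⟶ B} {s : B ⟶ A}
    (hs : s ≫ p = 𝟙 B) {g : P ⟶ A} {q : P ⟶ E} (h : IsPullback g q p f) {a b : A ⟶ Z}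
    (hg : g ≫ a = g ≫ b) (hs' : s ≫ a = s ≫ b) : a = b := by
  have := Protomodular.isIso_of_mono hs h (equalizer.ι a b) (equalizer.lift_ι g hg)
    (equalizer.lift_ι s hs')
  exact eq_of_epi_equalizer

end Protomodular

/-! ### Composable pairs of a reflexive graph -/

namespace ReflexiveGraph

variable {C : Type u} [Category.{v} C]

section

variable [HasPullbacks C] (G : ReflexiveGraph C)

/-- The composable pairs of the form `(x, 1)`. -/
noncomputable def inl : G.X₁ ⟶ pullback G.c G.d :=
  pullback.lift (𝟙 _) (G.c ≫ G.e)
    (by rw [Category.assoc, G.e_d, Category.comp_id, Category.id_comp])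

/-- The composable pairs of the form `(1, y)`. -/
noncomputable def inr : G.X₁ ⟶ pullback G.c G.d :=
  pullback.lift (G.d ≫ G.e) (𝟙 _)
    (by rw [Category.assoc, G.e_c, Category.comp_id, Category.id_comp])

@[simp]
lemma inl_fst : G.inl ≫ pullback.fst G.c G.d = 𝟙 _ := pullback.lift_fst _ _ _

@[simp]
lemma inl_snd : G.inl ≫ pullback.snd G.c G.d = G.c ≫ G.e := pullback.lift_snd _ _ _

@[simp]
lemma inr_fst : G.inr ≫ pullback.fst G.c G.d = G.d ≫ G.e := pullback.lift_fst _ _ _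

@[simp]
lemma inr_snd : G.inr ≫ pullback.snd G.c G.d = 𝟙 _ := pullback.lift_snd _ _ _

/-- If the first arrow of a composable pair is an identity, it is the identity on the domain of the
second, so the second arrow determines the pair. -/
lemma isPullback_inr : IsPullback G.inr G.d (pullback.fst G.c G.d) G.e :=
  ⟨⟨G.inr_fst⟩, ⟨PullbackCone.IsLimit.mk _ (fun t => t.fst ≫ pullback.snd G.c G.d)
    (fun t => by
      have ht : t.fst ≫ pullback.snd G.c G.d ≫ G.d = t.snd := by
        rw [← pullback.condition, reassoc_of% t.condition, G.e_c, Category.comp_id]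
      apply pullback.hom_ext
      · rw [Category.assoc, Category.assoc, G.inr_fst, reassoc_of% ht, t.condition]
      · rw [Category.assoc, Category.assoc, G.inr_snd, Category.comp_id])
    (fun t => by
      rw [Category.assoc, ← pullback.condition, reassoc_of% t.condition, G.e_c, Category.comp_id])
    (fun t k h _ => by rw [← h, Category.assoc, G.inr_snd, Category.comp_id])⟩⟩

end

section

variable [Protomodular C] (G : ReflexiveGraph C)

/-- This is protomodularity for the point `(fst, inl)`, whose pullback along `e` has projection
`inr`. It reduces claims about all composable pairs to the pairs `(x, 1)` and `(1, y)`. -/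
lemma isIso_of_mono {M : C} (j : M ⟶ pullback G.c G.d) [Mono j] {l r : G.X₁ ⟶ M}
    (hl : l ≫ j = G.inl) (hr : r ≫ j = G.inr) : IsIso j :=
  Protomodular.isIso_of_mono G.inl_fst G.isPullback_inr j hr hl

variable [HasEqualizers C]

variable {G} in
lemma hom_ext {Z : C} {a b : pullback G.c G.d ⟶ Z} (hl : G.inl ≫ a = G.inl ≫ b)
    (hr : G.inr ≫ a = G.inr ≫ b) : a = b :=
  Protomodular.hom_ext G.inl_fst G.isPullback_inr hr hl

end

end ReflexiveGraph

/-! ### Unital multiplications are groupoid structures -/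

namespace ReflexiveGraph

variable {C : Type u} [Category.{v} C]

/-- A unital multiplication on a reflexive graph. -/
structure Multiplication [HasPullbacks C] (G : ReflexiveGraph C) where
  m : pullback G.c G.d ⟶ G.X₁
  inl_m : G.inl ≫ m = 𝟙 _
  inr_m : G.inr ≫ m = 𝟙 _

namespace Multiplication

variable [Protomodular C] {G : ReflexiveGraph C} (μ : G.Multiplication)

lemma comp_lift_m {S T : C} (k : S ⟶ T) (f g : T ⟶ G.X₁)
    (h : f ≫ G.c = g ≫ G.d) :
    k ≫ pullback.lift f g h ≫ μ.m = pullback.lift (k ≫ f) (k ≫ g)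
      (by rw [Category.assoc, Category.assoc, h]) ≫ μ.m := by
  rw [← Category.assoc]
  congr 1
  apply pullback.hom_ext <;> simp [pullback.lift_fst, pullback.lift_snd]

lemma lift_m_congr {T : C} {f f' g g' : T ⟶ G.X₁} (hf : f = f') (hg : g = g')
    (h : f ≫ G.c = g ≫ G.d) (h' : f' ≫ G.c = g' ≫ G.d) :
    pullback.lift f g h ≫ μ.m = pullback.lift f' g' h' ≫ μ.m := by
  subst hf hg
  rfl

/-- The composable triples of the form `(1, y, z)`. -/
lemma isPullback_triple : IsPullback
    (pullback.lift (pullback.fst G.c G.d ≫ G.inr) (pullback.snd G.c G.d)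
      (by rw [Category.assoc, reassoc_of% G.inr_snd, pullback.condition]))
    (pullback.fst G.c G.d)
    (pullback.fst (pullback.snd G.c G.d ≫ G.c) G.d) G.inr :=
  ⟨⟨pullback.lift_fst _ _ _⟩, ⟨PullbackCone.IsLimit.mk _
    (fun t => pullback.lift t.snd (t.fst ≫ pullback.snd _ _) (by
      have := t.condition =≫ (pullback.snd G.c G.d ≫ G.c)
      rw [Category.assoc, Category.assoc, pullback.condition, reassoc_of% G.inr_snd] at this
      rw [Category.assoc, this]))
    (fun t => by
      apply pullback.hom_ext
      · rw [Category.assoc, pullback.lift_fst, pullback.lift_fst_assoc, t.condition]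
      · rw [Category.assoc, pullback.lift_snd, pullback.lift_snd])
    (fun t => pullback.lift_fst _ _ _)
    (fun t k h₁ h₂ => by
      apply pullback.hom_ext
      · rw [pullback.lift_fst, h₂]
      · rw [pullback.lift_snd, ← h₁, Category.assoc, pullback.lift_snd])⟩⟩

lemma lift_m_one {T : C} (f g : T ⟶ G.X₁) (h : f ≫ G.c = g ≫ G.d) (hg : g = f ≫ G.c ≫ G.e) :
    pullback.lift f g h ≫ μ.m = f := by
  subst hg
  have := f ≫= μ.inl_m
  rw [← Category.assoc, Category.comp_id] at this
  refine Eq.trans ?_ this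
  congr 1
  apply pullback.hom_ext <;> simp [pullback.lift_fst, pullback.lift_snd]

lemma lift_one_m {T : C} (f g : T ⟶ G.X₁) (h : f ≫ G.c = g ≫ G.d) (hf : f = g ≫ G.d ≫ G.e) :
    pullback.lift f g h ≫ μ.m = g := by
  subst hf
  have := g ≫= μ.inr_m
  rw [← Category.assoc, Category.comp_id] at this
  refine Eq.trans ?_ this
  congr 1
  apply pullback.hom_ext <;> simp [pullback.lift_fst, pullback.lift_snd]

variable [HasEqualizers C]

lemma m_d : μ.m ≫ G.d = pullback.fst G.c G.d ≫ G.d := by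
  apply ReflexiveGraph.hom_ext
  · rw [reassoc_of% μ.inl_m, reassoc_of% G.inl_fst]
  · rw [reassoc_of% μ.inr_m, reassoc_of% G.inr_fst, G.e_d, Category.comp_id]

lemma m_c : μ.m ≫ G.c = pullback.snd G.c G.d ≫ G.c := by
  apply ReflexiveGraph.hom_ext
  · rw [reassoc_of% μ.inl_m, reassoc_of% G.inl_snd, G.e_c, Category.comp_id]
  · rw [reassoc_of% μ.inr_m, reassoc_of% G.inr_snd]

lemma lift_m_d {T : C} (f g : T ⟶ G.X₁) (h : f ≫ G.c = g ≫ G.d) :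
    (pullback.lift f g h ≫ μ.m) ≫ G.d = f ≫ G.d := by
  rw [Category.assoc, μ.m_d, pullback.lift_fst_assoc]

lemma lift_m_c {T : C} (f g : T ⟶ G.X₁) (h : f ≫ G.c = g ≫ G.d) :
    (pullback.lift f g h ≫ μ.m) ≫ G.c = g ≫ G.c := by
  rw [Category.assoc, μ.m_c, pullback.lift_snd_assoc]

/-- Composable triples form a point over composable pairs, with section `(x, y) ↦ (x, y, 1)`; its
pullback along `inr` consists of the triples `(1, y, z)`. On both families an outer factor is an
identity, so the unit laws suffice. -/
lemma assoc {T : C} (f g h : T ⟶ G.X₁) (hfg : f ≫ G.c = g ≫ G.d) (hgh : g ≫ G.c = h ≫ G.d) :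
    pullback.lift (pullback.lift f g hfg ≫ μ.m) h (by rw [lift_m_c, hgh]) ≫ μ.m =
      pullback.lift f (pullback.lift g h hgh ≫ μ.m) (by rw [lift_m_d, hfg]) ≫ μ.m := by
  -- Associativity after restriction along any `k` that turns the third or the first factor into an
  -- identity.
  have key : ∀ {P : C} (f g h : P ⟶ G.X₁) (hfg : f ≫ G.c = g ≫ G.d) (hgh : g ≫ G.c = h ≫ G.d)
      {S : C} (k : S ⟶ P), (k ≫ h = (k ≫ g) ≫ G.c ≫ G.e ∨ k ≫ f = (k ≫ g) ≫ G.d ≫ G.e) →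
      k ≫ pullback.lift (pullback.lift f g hfg ≫ μ.m) h (by rw [lift_m_c, hgh]) ≫ μ.m =
        k ≫ pullback.lift f (pullback.lift g h hgh ≫ μ.m) (by rw [lift_m_d, hfg]) ≫ μ.m := by
    intro P f g h hfg hgh S k hk
    have hfg' : (k ≫ f) ≫ G.c = (k ≫ g) ≫ G.d := by simp only [Category.assoc, hfg]
    have hgh' : (k ≫ g) ≫ G.c = (k ≫ h) ≫ G.d := by simp only [Category.assoc, hgh]
    refine (μ.comp_lift_m _ _ _ _).trans (Eq.trans ?_ (μ.comp_lift_m _ _ _ _).symm)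
    refine (μ.lift_m_congr (μ.comp_lift_m _ _ _ _) rfl _ (by rw [lift_m_c, hgh'])).trans
      (Eq.trans ?_ (μ.lift_m_congr rfl (μ.comp_lift_m _ _ _ _) _ (by rw [lift_m_d, hfg'])).symm)
    rcases hk with hk | hk
    · refine (μ.lift_m_one _ _ _ (by rw [hk, ← Category.assoc (pullback.lift _ _ _ ≫ _), lift_m_c,
        Category.assoc _ G.c])).trans ?_
      exact μ.lift_m_congr rfl (μ.lift_m_one _ _ hgh' hk).symm _ _
    · refine Eq.trans ?_ (μ.lift_one_m _ _ _ (by rw [hk, ← Category.assoc (pullback.lift _ _ _ ≫ _),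
        lift_m_d, Category.assoc _ G.d])).symm
      exact μ.lift_m_congr (μ.lift_one_m _ _ hfg' hk) rfl _ _
  -- The object of composable triples carries the universal instance `(x, y, z)`, from which the
  -- general one is obtained by substitution.
  let A := pullback (pullback.snd G.c G.d ≫ G.c) G.d
  let x : A ⟶ G.X₁ := pullback.fst _ _ ≫ pullback.fst G.c G.d
  let y : A ⟶ G.X₁ := pullback.fst _ _ ≫ pullback.snd G.c G.d
  let z : A ⟶ G.X₁ := pullback.snd _ _
  have hxy : x ≫ G.c = y ≫ G.d := by simp only [x, y, Category.assoc, pullback.condition]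
  have hyz : y ≫ G.c = z ≫ G.d := by
    simp only [y, z, Category.assoc]; exact pullback.condition
  have univ : pullback.lift (pullback.lift x y hxy ≫ μ.m) z (by rw [lift_m_c, hyz]) ≫ μ.m =
      pullback.lift x (pullback.lift y z hyz ≫ μ.m) (by rw [lift_m_d, hxy]) ≫ μ.m := by
    refine Protomodular.hom_ext (s := pullback.lift (𝟙 _) (pullback.snd G.c G.d ≫ G.c ≫ G.e)
      (by simp [G.e_d])) (pullback.lift_fst _ _ _) (isPullback_triple (G := G)) ?_ ?_
    · exact key _ _ _ _ _ _ (Or.inr (by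
        simp only [x, y, Category.assoc, pullback.lift_fst_assoc, inr_fst]
        rw [reassoc_of% G.inr_snd]))
    · exact key _ _ _ _ _ _ (Or.inl (by
        simp only [y, z, pullback.lift_fst_assoc, pullback.lift_snd,
          Category.id_comp]))
  have := (pullback.lift (pullback.lift f g hfg) h
    (by simpa [pullback.lift_snd_assoc] using hgh) : T ⟶ A) ≫= univ
  simpa only [comp_lift_m, x, y, z, pullback.lift_fst_assoc, pullback.lift_fst,
    pullback.lift_snd] using this

/-- The map `(x, y) ↦ (x, xy)` goes from composable pairs to pairs with common domain, and is a
morphism of points over `X₁`. Pulled back along `e` it becomes the identity of `X₁`, so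
protomodularity applies. Its inverse is left division. -/
lemma isIso_fst_m : IsIso (pullback.lift (pullback.fst G.c G.d) μ.m μ.m_d.symm :
    pullback G.c G.d ⟶ pullback G.d G.d) := by
  let s : G.X₁ ⟶ pullback G.d G.d := pullback.lift (𝟙 _) (𝟙 _) rfl
  let r : G.X₁ ⟶ pullback G.d G.d := pullback.lift (G.d ≫ G.e) (𝟙 _) (by simp [G.e_d])
  have hr : IsPullback r G.d (pullback.fst G.d G.d) G.e := by
    refine ⟨⟨pullback.lift_fst _ _ _⟩, ⟨PullbackCone.IsLimit.mk _
      (fun t => t.fst ≫ pullback.snd _ _) (fun t => ?_) (fun t => ?_) (fun t k h _ => ?_)⟩⟩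
    · have ht : t.fst ≫ pullback.snd G.d G.d ≫ G.d = t.snd := by
        rw [← pullback.condition, reassoc_of% t.condition, G.e_d, Category.comp_id]
      apply pullback.hom_ext
      · simp only [r, Category.assoc, pullback.lift_fst]
        rw [reassoc_of% ht, t.condition]
      · simp only [r, Category.assoc, pullback.lift_snd, Category.comp_id]
    · rw [Category.assoc, ← pullback.condition, reassoc_of% t.condition, G.e_d, Category.comp_id]
    · rw [← h, Category.assoc, pullback.lift_snd, Category.comp_id]
  refine Protomodular.isIso_of_isIso_pullback G.e (pullback.fst G.c G.d) G.inl G.inl_fst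
    (pullback.fst G.d G.d) s (pullback.lift_fst _ _ _) _ (pullback.lift_fst _ _ _) ?_ G.inr G.d
    G.isPullback_inr r G.d hr (𝟙 _) ?_ (Category.id_comp _) inferInstance
  · apply pullback.hom_ext <;> simp [s, pullback.lift_fst, pullback.lift_snd, μ.inl_m]
  · apply pullback.hom_ext <;> simp [r, pullback.lift_fst, pullback.lift_snd, μ.inr_m]

lemma exists_right_inverse : ∃ (i : G.X₁ ⟶ G.X₁) (h : 𝟙 _ ≫ G.c = i ≫ G.d), i ≫ G.c = G.d ∧
    pullback.lift (𝟙 _) i h ≫ μ.m = G.d ≫ G.e := by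
  have := μ.isIso_fst_m
  set φ : pullback G.c G.d ⟶ pullback G.d G.d :=
    pullback.lift (pullback.fst G.c G.d) μ.m μ.m_d.symm with hφ
  -- Dividing the identity on the domain of `x` by `x`: the pair `k` is `(x, x⁻¹)`.
  let k : G.X₁ ⟶ pullback G.c G.d :=
    pullback.lift (𝟙 _) (G.d ≫ G.e) (by simp [G.e_d]) ≫ inv φ
  have hk : k ≫ φ = pullback.lift (𝟙 _) (G.d ≫ G.e) (by simp [G.e_d]) := by simp [k]
  have k_fst : k ≫ pullback.fst G.c G.d = 𝟙 _ := by
    have := hk =≫ pullback.fst G.d G.d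
    rwa [Category.assoc, pullback.lift_fst, pullback.lift_fst] at this
  have k_m : k ≫ μ.m = G.d ≫ G.e := by
    have := hk =≫ pullback.snd G.d G.d
    rwa [Category.assoc, pullback.lift_snd, pullback.lift_snd] at this
  have hi : 𝟙 _ ≫ G.c = (k ≫ pullback.snd G.c G.d) ≫ G.d := by
    rw [Category.assoc, ← pullback.condition, reassoc_of% k_fst, Category.id_comp]
  refine ⟨k ≫ pullback.snd G.c G.d, hi, ?_, ?_⟩
  · rw [Category.assoc, ← μ.m_c, reassoc_of% k_m, G.e_c, Category.comp_id]
  · rw [← k_m]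
    congr 1
    apply pullback.hom_ext <;> simp [pullback.lift_fst, pullback.lift_snd, k_fst]

/-- The inversion of a unital multiplication. -/
noncomputable def inversion : G.X₁ ⟶ G.X₁ := μ.exists_right_inverse.choose

lemma inversion_d : μ.inversion ≫ G.d = G.c := by
  exact μ.exists_right_inverse.choose_spec.choose.symm.trans (Category.id_comp _)

lemma inversion_c : μ.inversion ≫ G.c = G.d :=
  μ.exists_right_inverse.choose_spec.choose_spec.1

lemma m_inversion :
    pullback.lift (𝟙 _) μ.inversion (by rw [inversion_d, Category.id_comp]) ≫ μ.m = G.d ≫ G.e :=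
  μ.exists_right_inverse.choose_spec.choose_spec.2

/-- Associativity of `x · x⁻¹ · (x⁻¹)⁻¹` gives `(x⁻¹)⁻¹ = x`, so the right inverse law for `x⁻¹` is
the left one for `x`. -/
lemma inversion_m :
    pullback.lift μ.inversion (𝟙 _) (by rw [inversion_c, Category.id_comp]) ≫ μ.m = G.c ≫ G.e := by
  have h₁ : 𝟙 _ ≫ G.c = μ.inversion ≫ G.d := by rw [inversion_d, Category.id_comp]
  have h₂ : μ.inversion ≫ G.c = (μ.inversion ≫ μ.inversion) ≫ G.d := by
    rw [Category.assoc, inversion_d]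
  have e₂ : pullback.lift μ.inversion (μ.inversion ≫ μ.inversion) h₂ ≫ μ.m = G.c ≫ G.e := by
    have := μ.inversion ≫= μ.m_inversion
    rw [comp_lift_m] at this
    simp only [Category.comp_id] at this
    rw [this, reassoc_of% μ.inversion_d]
  have key := μ.assoc _ _ _ h₁ h₂
  rw [μ.lift_one_m _ _ _ (by rw [m_inversion, Category.assoc, reassoc_of% μ.inversion_d,
      reassoc_of% μ.inversion_c]),
    μ.lift_m_one _ _ _ (by rw [e₂, Category.id_comp])] at key
  rw [← e₂]
  exact μ.lift_m_congr rfl key.symm _ _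

/-- In a protomodular category, a unital multiplication on a reflexive graph is the composition of
an internal groupoid. -/
noncomputable def toInternalGroupoid : InternalGroupoid C where
  toReflexiveGraph := G
  m := μ.m
  m_d := μ.m_d
  m_c := μ.m_c
  id_m := μ.inr_m
  m_id := μ.inl_m
  assoc f g h hfg hgh := μ.assoc f g h hfg hgh
  i := μ.inversion
  i_d := μ.inversion_d
  i_c := μ.inversion_c
  m_i := μ.m_inversion
  i_m := μ.inversion_m

end Multiplication

end ReflexiveGraph

namespace InternalGroupoid

variable {C : Type u} [Category.{v} C]

lemma inl_m [HasPullbacks C] (X : InternalCategory C) : X.inl ≫ X.m = 𝟙 _ := X.m_id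

lemma inr_m [HasPullbacks C] (X : InternalCategory C) : X.inr ≫ X.m = 𝟙 _ := X.id_m

/-- In a protomodular category, a morphism of reflexive graphs between internal groupoids is an
internal functor. -/
@[simps]
def homOfGraph [Protomodular C] [HasEqualizers C] {X Y : InternalGroupoid C} (f₀ : X.X₀ ⟶ Y.X₀)
    (f₁ : X.X₁ ⟶ Y.X₁) (w_d : f₁ ≫ Y.d = X.d ≫ f₀) (w_c : f₁ ≫ Y.c = X.c ≫ f₀)
    (w_e : X.e ≫ f₁ = f₀ ≫ Y.e) : X ⟶ Y where
  f₀ := f₀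
  f₁ := f₁
  w_d := w_d
  w_c := w_c
  w_e := w_e
  w_m := by
    apply ReflexiveGraph.hom_ext
    · rw [reassoc_of% inl_m X.toInternalCategory, comp_lift_m, lift_m_id]
      · rw [reassoc_of% X.inl_fst]
      · rw [reassoc_of% X.inl_fst, reassoc_of% X.inl_snd, w_e, reassoc_of% w_c]
    · rw [reassoc_of% inr_m X.toInternalCategory, comp_lift_m, lift_id_m]
      · rw [reassoc_of% X.inr_snd]
      · rw [reassoc_of% X.inr_fst, reassoc_of% X.inr_snd, w_e, reassoc_of% w_d]

end InternalGroupoid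

/-- Effectiveness provides some morphism with the given kernel pair; the regular epimorphism in its
image factorisation has the same kernel pair, since the other factor is monic. -/
lemma BarrExact.exists_quotient {C : Type u} [Category.{v} C] [BarrExact C] {R X : C}
    (p₁ p₂ : R ⟶ X) [h : IsEquivalenceRelation p₁ p₂] :
    ∃ (Y : C) (q : X ⟶ Y), IsKernelPair q p₁ p₂ ∧ IsRegularEpi q := by
  obtain ⟨Y, f, hf⟩ := BarrExact.effective p₁ p₂ h
  let F := Regular.strongEpiMonoFactorisation f
  have hF : IsKernelPair (F.e ≫ F.m) p₁ p₂ := by rwa [F.fac]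
  exact ⟨F.I, F.e, hF.cancel_right_of_mono, inferInstanceAs (IsRegularEpi F.e)⟩

/-! ### The Mal'cev property -/

section Malcev

variable {C : Type u} [Category.{v} C] [Protomodular C] [HasFiniteLimits C]

/-- In a relation, the composite of `(x, y)` can only be the arrow from the domain of `x` to the
codomain of `y`. The pairs for which it exists form a subobject `j` containing `inl` and `inr`,
hence all pairs. -/
lemma ReflexiveGraph.nonempty_multiplication_of_jointlyMono (G : ReflexiveGraph C)
    [h : JointlyMono₂ G.d G.c] : Nonempty G.Multiplication := by
  have hm : Mono (prod.lift G.d G.c) := ⟨fun a b hab => h.right_cancellation a b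
    (by simpa [prod.lift_fst] using hab =≫ prod.fst)
    (by simpa [prod.lift_snd] using hab =≫ prod.snd)⟩
  let t : pullback G.c G.d ⟶ G.X₀ ⨯ G.X₀ :=
    prod.lift (pullback.fst _ _ ≫ G.d) (pullback.snd _ _ ≫ G.c)
  let j := pullback.fst t (prod.lift G.d G.c)
  have hl : G.inl ≫ t = 𝟙 _ ≫ prod.lift G.d G.c := by
    apply Limits.prod.hom_ext
    · simp only [t, Category.assoc, prod.lift_fst, Category.id_comp, reassoc_of% G.inl_fst]
    · simp only [t, Category.assoc, prod.lift_snd, Category.id_comp, reassoc_of% G.inl_snd, G.e_c,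
        Category.comp_id]
  have hr : G.inr ≫ t = 𝟙 _ ≫ prod.lift G.d G.c := by
    apply Limits.prod.hom_ext
    · simp only [t, Category.assoc, prod.lift_fst, Category.id_comp, reassoc_of% G.inr_fst, G.e_d,
        Category.comp_id]
    · simp only [t, Category.assoc, prod.lift_snd, Category.id_comp, reassoc_of% G.inr_snd]
  have : IsIso j := G.isIso_of_mono j (pullback.lift_fst _ _ hl) (pullback.lift_fst _ _ hr)
  have key : ∀ k : G.X₁ ⟶ pullback G.c G.d, ∀ hk : k ≫ t = 𝟙 _ ≫ prod.lift G.d G.c,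
      k ≫ inv j ≫ pullback.snd _ _ = 𝟙 _ := fun k hk => by
    have : k = pullback.lift _ _ hk ≫ j := (pullback.lift_fst _ _ _).symm
    rw [this, Category.assoc, IsIso.hom_inv_id_assoc, pullback.lift_snd]
  exact ⟨⟨inv j ≫ pullback.snd _ _, key _ hl, key _ hr⟩⟩

/-- Protomodular categories are Mal'cev categories: reflexive relations are equivalence relations.
-/
lemma Protomodular.isEquivalenceRelation {R X : C} {p₁ p₂ : R ⟶ X} [h : JointlyMono₂ p₁ p₂]
    {r : X ⟶ R} (h₁ : r ≫ p₁ = 𝟙 X) (h₂ : r ≫ p₂ = 𝟙 X) : IsEquivalenceRelation p₁ p₂ := by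
  let G : ReflexiveGraph C := ⟨X, R, p₁, p₂, r, h₁, h₂⟩
  have : JointlyMono₂ G.d G.c := h
  obtain ⟨μ⟩ := G.nonempty_multiplication_of_jointlyMono
  exact ⟨⟨{
    right_cancellation := h.right_cancellation
    r := r
    reflexivity₁ := h₁
    reflexivity₂ := h₂
    s := μ.inversion
    symmetry₁ := μ.inversion_d
    symmetry₂ := μ.inversion_c
    c := pullback.cone p₂ p₁
    isLimit := pullback.isLimit p₂ p₁
    t := μ.m
    transitivity₁ := μ.m_d
    transitivity₂ := μ.m_c }⟩⟩

end Malcev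

/-! ### Coequalizers and pushouts in semi-abelian categories -/

section Colimits

variable {C : Type u} [Category.{v} C] [SemiAbelian C]

/-- The image of `A ⨿ B ⟶ B ⨯ B`, given by `(f, g)` on `A` and the diagonal on `B`, is the reflexive
relation generated by `f` and `g`. It is an equivalence relation by the Mal'cev property, and its
effective quotient is the coequalizer. -/
lemma SemiAbelian.exists_coequalizer {A B : C} (f g : A ⟶ B) :
    ∃ (Y : C) (q : B ⟶ Y) (w : f ≫ q = g ≫ q), Nonempty (IsColimit (Cofork.ofπ q w)) := by
  let φ : A ⨿ B ⟶ B ⨯ B := coprod.desc (prod.lift f g) (prod.lift (𝟙 B) (𝟙 B))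
  let F := Regular.strongEpiMonoFactorisation φ
  have he : StrongEpi F.e := inferInstanceAs (StrongEpi (Regular.strongEpiMonoFactorisation φ).e)
  have hfac : F.e ≫ F.m = φ := F.fac
  have h : JointlyMono₂ (F.m ≫ prod.fst) (F.m ≫ prod.snd) := ⟨fun Z a b h₁ h₂ => by
    rw [← cancel_mono F.m]
    apply Limits.prod.hom_ext <;> simpa⟩
  have φ₁ : F.e ≫ F.m ≫ prod.fst = coprod.desc f (𝟙 B) := by
    rw [reassoc_of% hfac, coprod.desc_comp, prod.lift_fst, prod.lift_fst]
  have φ₂ : F.e ≫ F.m ≫ prod.snd = coprod.desc g (𝟙 B) := by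
    rw [reassoc_of% hfac, coprod.desc_comp, prod.lift_snd, prod.lift_snd]
  have := Protomodular.isEquivalenceRelation (p₁ := F.m ≫ prod.fst) (p₂ := F.m ≫ prod.snd)
    (r := coprod.inr ≫ F.e) (by rw [Category.assoc, φ₁, coprod.inr_desc])
    (by rw [Category.assoc, φ₂, coprod.inr_desc])
  obtain ⟨Y, q, hq, _⟩ := BarrExact.exists_quotient (F.m ≫ prod.fst) (F.m ≫ prod.snd)
  have hf : (coprod.inl ≫ F.e) ≫ F.m ≫ prod.fst = f := by
    rw [Category.assoc, φ₁, coprod.inl_desc]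
  have hg : (coprod.inl ≫ F.e) ≫ F.m ≫ prod.snd = g := by
    rw [Category.assoc, φ₂, coprod.inl_desc]
  have w : f ≫ q = g ≫ q := by
    calc f ≫ q = (coprod.inl ≫ F.e) ≫ (F.m ≫ prod.fst) ≫ q := by rw [← Category.assoc, hf]
      _ = g ≫ q := by rw [hq.w, ← Category.assoc, hg]
  refine ⟨Y, q, w, ⟨Cofork.IsColimit.mk' _ fun s => ?_⟩⟩
  have hs : (F.m ≫ prod.fst) ≫ s.π = (F.m ≫ prod.snd) ≫ s.π := by
    rw [← cancel_epi F.e, ← Category.assoc F.e _ s.π, φ₁, ← Category.assoc F.e _ s.π, φ₂]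
    apply coprod.hom_ext
    · rw [coprod.inl_desc_assoc, coprod.inl_desc_assoc, s.condition]
    · rw [coprod.inr_desc_assoc, coprod.inr_desc_assoc]
  have hu := IsRegularEpi.exists_of_isKernelPair q hq s.π hs
  refine ⟨hu.choose, hu.choose_spec, fun {m} hm => ?_⟩
  rw [← cancel_epi q]
  exact hm.trans hu.choose_spec.symm

instance SemiAbelian.hasCoequalizers : HasCoequalizers C :=
  have (A B : C) (f g : A ⟶ B) : HasColimit (parallelPair f g) := by
    obtain ⟨Y, q, w, ⟨h⟩⟩ := SemiAbelian.exists_coequalizer f g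
    exact ⟨⟨⟨_, h⟩⟩⟩
  hasCoequalizers_of_hasColimit_parallelPair C

instance SemiAbelian.hasPushouts : HasPushouts C :=
  hasPushouts_of_hasBinaryCoproducts_of_hasCoequalizers C

end Colimits

/-! ### Transfer of exactness and protomodularity along functors -/

lemma IsKernelPair.isIso_of_fac {C : Type*} [Category* C] {R X Y Z : C} {p₁ p₂ : R ⟶ X} {q : X ⟶ Y}
    {f : X ⟶ Z} [IsRegularEpi q] [IsRegularEpi f] (hq : IsKernelPair q p₁ p₂)
    (hf : IsKernelPair f p₁ p₂) {m : Y ⟶ Z} (hm : q ≫ m = f) : IsIso m := by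
  obtain ⟨n, hn⟩ := IsRegularEpi.exists_of_isKernelPair f hf q hq.w
  refine ⟨n, ?_, ?_⟩
  · rw [← cancel_epi q, reassoc_of% hm, hn, Category.comp_id]
  · rw [← cancel_epi f, reassoc_of% hn, hm, Category.comp_id]

lemma IsKernelPair.isEquivalenceRelation {C : Type*} [Category* C] [HasPullbacks C] {R X Y : C}
    {f : X ⟶ Y} {p₁ p₂ : R ⟶ X} (h : IsKernelPair f p₁ p₂) : IsEquivalenceRelation p₁ p₂ :=
  (IsKernelPair.equivalenceRelation f p₁ p₂ (pullback.isLimit p₂ p₁) h).isEquivalenceRelation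

/-- If a functor preserves finite limits, it preserves jointly monomorphic pairs. -/
lemma JointlyMono₂.map {C D : Type*} [Category* C] [Category* D] [HasFiniteLimits C] (F : C ⥤ D)
    [PreservesFiniteLimits F] {R X : C} {p₁ p₂ : R ⟶ X} (h : JointlyMono₂ p₁ p₂) :
    JointlyMono₂ (F.map p₁) (F.map p₂) := by
  have : Mono (prod.lift p₁ p₂) := ⟨fun a b hab => h.right_cancellation a b
    (by simpa [prod.lift_fst] using hab =≫ prod.fst)
    (by simpa [prod.lift_snd] using hab =≫ prod.snd)⟩
  refine ⟨fun Z a b h₁ h₂ => ?_⟩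
  rw [← cancel_mono (F.map (prod.lift p₁ p₂))]
  apply BinaryFan.IsLimit.hom_ext (isLimitOfHasBinaryProductOfPreservesLimit F X X)
  · simpa [← F.map_comp, prod.lift_fst] using h₁
  · simpa [← F.map_comp, prod.lift_snd] using h₂

lemma IsEquivalenceRelation.map {C D : Type*} [Category* C] [Category* D] [HasFiniteLimits C]
    (F : C ⥤ D) [PreservesFiniteLimits F] {R X : C} (p₁ p₂ : R ⟶ X)
    [h : IsEquivalenceRelation p₁ p₂] : IsEquivalenceRelation (F.map p₁) (F.map p₂) := by
  obtain ⟨⟨h⟩⟩ := h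
  have := h.toJointlyMono₂.map F
  exact ⟨⟨{ h.toReflexiveRelation.map F, h.toSymmetricRelation.map F,
    h.toTransitiveRelation.map F with }⟩⟩

/-- A family of functors that jointly reflects isomorphisms, and such that every equivalence
relation in the source has a regular quotient which is effective and is sent to regular
epimorphisms. -/
structure ReflectsExactness {D : Type*} {E : Type*} {I : Type*} [Category* D] [Category* E]
    (F : I → D ⥤ E) : Prop where
  isIso_of_map : ∀ {X Y : D} (f : X ⟶ Y), (∀ i, IsIso ((F i).map f)) → IsIso f
  exists_quotient : ∀ {R X : D} (p₁ p₂ : R ⟶ X), IsEquivalenceRelation p₁ p₂ →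
    ∃ (Y : D) (q : X ⟶ Y), IsKernelPair q p₁ p₂ ∧ IsRegularEpi q ∧ ∀ i, IsRegularEpi ((F i).map q)

namespace ReflectsExactness

variable {D : Type*} {E : Type*} {I : Type*} [Category* D] [Category* E] {F : I → D ⥤ E}
  [HasFiniteLimits D]

/-- Up to isomorphism `f` is the chosen quotient of its own kernel pair, and that quotient is sent
to regular epimorphisms. -/
lemma isRegularEpi_map (hF : ReflectsExactness F) {X Y : D} (f : X ⟶ Y) [IsRegularEpi f] (i : I) :
    IsRegularEpi ((F i).map f) := by
  have hf := IsKernelPair.of_hasPullback f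
  obtain ⟨Z, q, hq, _, h⟩ := hF.exists_quotient _ _ hf.isEquivalenceRelation
  obtain ⟨m, hm⟩ := IsRegularEpi.exists_of_isKernelPair q hq f hf.w
  have := hq.isIso_of_fac hf hm
  rw [← hm, (F i).map_comp]
  exact MorphismProperty.RespectsIso.postcomp (MorphismProperty.regularEpi E) _ _ (h i)

variable [∀ i, PreservesFiniteLimits (F i)]

/-- The comparison `m` from the quotient by the kernel pair of `f` becomes invertible under each `F
i`, because there both sides are regular epimorphisms with the same kernel pair. -/
lemma isRegularEpi_of_map (hF : ReflectsExactness F) {X Y : D} (f : X ⟶ Y)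
    (h : ∀ i, IsRegularEpi ((F i).map f)) :
    IsRegularEpi f := by
  have hf := IsKernelPair.of_hasPullback f
  obtain ⟨Z, q, hq, hq', h'⟩ := hF.exists_quotient _ _ hf.isEquivalenceRelation
  obtain ⟨m, hm⟩ := IsRegularEpi.exists_of_isKernelPair q hq f hf.w
  have : IsIso m := hF.isIso_of_map m fun i => by
    have := h i
    have := h' i
    exact IsKernelPair.isIso_of_fac (IsPullback.map (F i) hq) (IsPullback.map (F i) hf)
      (by rw [← (F i).map_comp, hm])
  rw [← hm]
  exact MorphismProperty.RespectsIso.postcomp (MorphismProperty.regularEpi D) _ _ hq'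

lemma barrExact (hF : ReflectsExactness F) [Regular E] : BarrExact D where
  hasCoequalizer_of_isKernelPair {X Y Z f g₁ g₂} hf := by
    obtain ⟨Z, q, hq, hq', -⟩ := hF.exists_quotient _ _ hf.isEquivalenceRelation
    exact ⟨⟨⟨_, hq.toCoequalizer'⟩⟩⟩
  regularEpiIsStableUnderBaseChange := ⟨fun {X Y Y' S f g f' g'} h hg => by
    have : IsRegularEpi g := hg
    refine hF.isRegularEpi_of_map _ fun i => ?_
    have := hF.isRegularEpi_map g i
    exact Regular.regularEpiIsStableUnderBaseChange.of_isPullback (IsPullback.map (F i) h) this⟩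
  effective p₁ p₂ h := by
    obtain ⟨Y, q, hq, -⟩ := hF.exists_quotient p₁ p₂ h
    exact ⟨Y, q, hq⟩

lemma protomodular (hF : ReflectsExactness F) [Protomodular E] : Protomodular D where
  isIso_of_isIso_pullback f p s hs p' s' hs' b hb hb' _ _ g q h g' q' h' a ha ha' _ :=
    hF.isIso_of_map b fun i => Protomodular.isIso_of_isIso_pullback ((F i).map f) ((F i).map p)
      ((F i).map s) (by rw [← Functor.map_comp, hs, Functor.map_id]) ((F i).map p') ((F i).map s')
      (by rw [← Functor.map_comp, hs', Functor.map_id]) _ (by rw [← Functor.map_comp, hb])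
      (by rw [← Functor.map_comp, hb']) _ _ (IsPullback.map (F i) h) _ _
      (IsPullback.map (F i) h') ((F i).map a) (by rw [← Functor.map_comp, ha, Functor.map_comp])
      (by rw [← Functor.map_comp, ha']) inferInstance

end ReflectsExactness

/-! ### Levelwise limits and isomorphisms of internal groupoids -/

lemma preservesPullbacks_of_isPullback {D E : Type*} [Category* D] [Category* E] (F : D ⥤ E)
    (h : ∀ {X Y Z : D} (f : X ⟶ Z) (g : Y ⟶ Z), ∃ (P : D) (p : P ⟶ X) (q : P ⟶ Y),
      IsPullback p q f g ∧ IsPullback (F.map p) (F.map q) (F.map f) (F.map g)) :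
    PreservesLimitsOfShape WalkingCospan F where
  preservesLimit {K} := by
    have : PreservesLimit
        (cospan (K.map WalkingCospan.Hom.inl) (K.map WalkingCospan.Hom.inr)) F := by
      obtain ⟨P, p, q, h₁, h₂⟩ := h (K.map WalkingCospan.Hom.inl) (K.map WalkingCospan.Hom.inr)
      exact preservesLimit_of_preserves_limit_cone h₁.isLimit
        ((isLimitMapConePullbackConeEquiv F h₁.w).symm h₂.isLimit)
    exact preservesLimit_of_iso_diagram F (diagramIsoCospan K).symm

lemma preservesFiniteLimits_of_isZero {D E : Type*} [Category* D] [Category* E] [HasPullbacks D]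
    [HasTerminal D] [HasTerminal E]
    (F : D ⥤ E) [PreservesLimitsOfShape WalkingCospan F] {Z : D} (hZ : IsZero Z)
    (hFZ : IsZero (F.obj Z)) : PreservesFiniteLimits F := by
  have := preservesTerminal_of_iso F
    (F.mapIso (terminalIsTerminal.uniqueUpToIso hZ.isTerminal) ≪≫
      hFZ.isTerminal.uniqueUpToIso terminalIsTerminal)
  have := preservesLimitsOfShape_pempty_of_preservesTerminal F
  exact preservesFiniteLimits_of_preservesTerminal_and_pullbacks F

namespace InternalGroupoid

section Limits

variable {C : Type u} [Category.{v} C]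

section

variable (C) [HasPullbacks C]

/-- The functor sending an internal groupoid to its object of objects. -/
@[simps]
def objects : InternalGroupoid C ⥤ C where
  obj X := X.X₀
  map F := F.f₀

/-- The functor sending an internal groupoid to its object of arrows. -/
@[simps]
def arrows : InternalGroupoid C ⥤ C where
  obj X := X.X₁
  map F := F.f₁

instance : PreservesLimitsOfShape WalkingCospan (objects C) :=
  preservesPullbacks_of_isPullback _ fun F G =>
    ⟨_, _, _, isPullback_pullbackGroupoid F G, IsPullback.of_hasPullback F.f₀ G.f₀⟩

instance : PreservesLimitsOfShape WalkingCospan (arrows C) :=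
  preservesPullbacks_of_isPullback _ fun F G =>
    ⟨_, _, _, isPullback_pullbackGroupoid F G, IsPullback.of_hasPullback F.f₁ G.f₁⟩

end

variable [Protomodular C] [HasFiniteLimits C]

lemma isIso_of_isIso {X Y : InternalGroupoid C} (F : X ⟶ Y) [IsIso F.f₀] [IsIso F.f₁] :
    IsIso F := by
  refine ⟨homOfGraph (inv F.f₀) (inv F.f₁) ?_ ?_ ?_, ?_, ?_⟩
  · rw [IsIso.inv_comp_eq, ← Category.assoc, IsIso.eq_comp_inv, F.w_d]
  · rw [IsIso.inv_comp_eq, ← Category.assoc, IsIso.eq_comp_inv, F.w_c]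
  · rw [IsIso.eq_inv_comp, ← Category.assoc, IsIso.comp_inv_eq, F.w_e]
  · ext <;> simp
  · ext <;> simp

lemma isPullback_of_isPullback {W X Y Z : InternalGroupoid C} {H : W ⟶ X} {K : W ⟶ Y}
    {F : X ⟶ Z} {G : Y ⟶ Z} (h₀ : IsPullback H.f₀ K.f₀ F.f₀ G.f₀)
    (h₁ : IsPullback H.f₁ K.f₁ F.f₁ G.f₁) : IsPullback H K F G := by
  have w : H ≫ F = K ≫ G := by ext; exacts [h₀.w, h₁.w]
  have : IsIso (pullbackLift H K w).f₀ := h₀.isoPullback.isIso_hom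
  have : IsIso (pullbackLift H K w).f₁ := h₁.isoPullback.isIso_hom
  have : IsIso (pullbackLift H K w) := isIso_of_isIso _
  refine IsPullback.of_iso (isPullback_pullbackGroupoid F G) (asIso (pullbackLift H K w)).symm
    (Iso.refl _) (Iso.refl _) (Iso.refl _) ?_ ?_ (by simp) (by simp)
  · rw [Iso.symm_hom, asIso_inv, Iso.refl_hom, Category.comp_id, IsIso.eq_inv_comp]
    ext
    · exact pullback.lift_fst _ _ _
    · exact pullback.lift_fst _ _ _
  · rw [Iso.symm_hom, asIso_inv, Iso.refl_hom, Category.comp_id, IsIso.eq_inv_comp]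
    ext
    · exact pullback.lift_snd _ _ _
    · exact pullback.lift_snd _ _ _

/-- The discrete groupoid on an object. -/
noncomputable def discrete (T : C) : InternalGroupoid C :=
  ReflexiveGraph.Multiplication.toInternalGroupoid (G := ⟨T, T, 𝟙 T, 𝟙 T, 𝟙 T, by simp, by simp⟩)
    ⟨pullback.fst _ _, ReflexiveGraph.inl_fst _, (ReflexiveGraph.inr_fst _).trans (by simp)⟩

lemma isZero_of_isZero {X : InternalGroupoid C} (h₀ : IsZero X.X₀) (h₁ : IsZero X.X₁) :
    IsZero X where
  unique_to Y := ⟨⟨⟨homOfGraph (h₀.to_ _) (h₁.to_ _) (h₁.eq_of_src _ _) (h₁.eq_of_src _ _)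
    (h₀.eq_of_src _ _)⟩, fun F => by ext; exacts [h₀.eq_of_src _ _, h₁.eq_of_src _ _]⟩⟩
  unique_from Y := ⟨⟨⟨homOfGraph (h₀.from_ _) (h₁.from_ _) (h₀.eq_of_tgt _ _) (h₀.eq_of_tgt _ _)
    (h₁.eq_of_tgt _ _)⟩, fun F => by ext; exacts [h₀.eq_of_tgt _ _, h₁.eq_of_tgt _ _]⟩⟩

variable [HasZeroObject C]

lemma exists_isZero : ∃ Z : InternalGroupoid C, IsZero Z ∧ IsZero Z.X₀ ∧ IsZero Z.X₁ := by
  obtain ⟨Z, hZ⟩ := HasZeroObject.zero (C := C)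
  exact ⟨discrete Z, isZero_of_isZero hZ hZ, hZ, hZ⟩

instance : HasZeroObject (InternalGroupoid C) := by
  obtain ⟨Z, hZ, -⟩ := exists_isZero (C := C)
  exact ⟨Z, hZ⟩

instance : HasFiniteLimits (InternalGroupoid C) := hasFiniteLimits_of_hasTerminal_and_pullbacks

instance : PreservesFiniteLimits (objects C) := by
  obtain ⟨Z, hZ, h₀, -⟩ := exists_isZero (C := C)
  exact preservesFiniteLimits_of_isZero _ hZ h₀

instance : PreservesFiniteLimits (arrows C) := by
  obtain ⟨Z, hZ, -, h₁⟩ := exists_isZero (C := C)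
  exact preservesFiniteLimits_of_isZero _ hZ h₁

end Limits

end InternalGroupoid

/-! ### Graph morphisms and descent of multiplications -/

namespace ReflexiveGraph

variable {C : Type u} [Category.{v} C]

/-- A morphism of reflexive graphs. -/
structure GraphHom (G H : ReflexiveGraph C) where
  f₀ : G.X₀ ⟶ H.X₀
  f₁ : G.X₁ ⟶ H.X₁
  w_d : f₁ ≫ H.d = G.d ≫ f₀
  w_c : f₁ ≫ H.c = G.c ≫ f₀
  w_e : G.e ≫ f₁ = f₀ ≫ H.e

namespace GraphHom

section

variable [HasPullbacks C] {G H : ReflexiveGraph C} (u : GraphHom G H)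

/-- The morphism induced by a morphism of reflexive graphs on composable pairs. -/
noncomputable def mapPairs : pullback G.c G.d ⟶ pullback H.c H.d :=
  pullback.lift (pullback.fst _ _ ≫ u.f₁) (pullback.snd _ _ ≫ u.f₁)
    (by rw [Category.assoc, Category.assoc, u.w_c, u.w_d, pullback.condition_assoc])

@[simp]
lemma mapPairs_fst : u.mapPairs ≫ pullback.fst _ _ = pullback.fst _ _ ≫ u.f₁ :=
  pullback.lift_fst _ _ _

@[simp]
lemma mapPairs_snd : u.mapPairs ≫ pullback.snd _ _ = pullback.snd _ _ ≫ u.f₁ :=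
  pullback.lift_snd _ _ _

lemma inl_mapPairs : G.inl ≫ u.mapPairs = u.f₁ ≫ H.inl := by
  apply pullback.hom_ext
  · rw [Category.assoc, mapPairs_fst, reassoc_of% G.inl_fst, Category.assoc, H.inl_fst,
      Category.comp_id]
  · rw [Category.assoc, mapPairs_snd, reassoc_of% G.inl_snd, Category.assoc, H.inl_snd, u.w_e,
      reassoc_of% u.w_c]

lemma inr_mapPairs : G.inr ≫ u.mapPairs = u.f₁ ≫ H.inr := by
  apply pullback.hom_ext
  · rw [Category.assoc, mapPairs_fst, reassoc_of% G.inr_fst, Category.assoc, H.inr_fst, u.w_e,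
      reassoc_of% u.w_d]
  · rw [Category.assoc, mapPairs_snd, reassoc_of% G.inr_snd, Category.assoc, H.inr_snd,
      Category.comp_id]

end

/-- Let `mapPairs` factor through a subobject `i`. Since `u.f₁` is a strong epimorphism, `inl` and
`inr` of `H` lift through `i`, so `i` is invertible. Extremal epimorphisms are regular here. -/
lemma isRegularEpi_mapPairs [Regular C] [Protomodular C] {G H : ReflexiveGraph C}
    (u : GraphHom G H) [IsRegularEpi u.f₁] : IsRegularEpi u.mapPairs := by
  have : ExtremalEpi u.mapPairs := .mk_of_hasEqualizers _ fun Z p i hp _ => by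
    have sq₁ : CommSq (G.inl ≫ p) u.f₁ i H.inl := ⟨by rw [Category.assoc, hp, u.inl_mapPairs]⟩
    have sq₂ : CommSq (G.inr ≫ p) u.f₁ i H.inr := ⟨by rw [Category.assoc, hp, u.inr_mapPairs]⟩
    exact H.isIso_of_mono i sq₁.fac_right sq₂.fac_right
  infer_instance

/-- A multiplication descends along a regular epimorphism of reflexive graphs as soon as it is
compatible with its kernel pair. -/
lemma nonempty_multiplication [Regular C] [Protomodular C] {G H : ReflexiveGraph C}
    (u : GraphHom G H) [IsRegularEpi u.f₁] (φ : pullback G.c G.d ⟶ H.X₁) (hl : G.inl ≫ φ = u.f₁)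
    (hr : G.inr ≫ φ = u.f₁)
    (hφ : ∀ {K : C} (k₁ k₂ : K ⟶ pullback G.c G.d), k₁ ≫ u.mapPairs = k₂ ≫ u.mapPairs →
      k₁ ≫ φ = k₂ ≫ φ) : Nonempty H.Multiplication := by
  have := u.isRegularEpi_mapPairs
  obtain ⟨m, hm⟩ := IsRegularEpi.exists_of_isKernelPair u.mapPairs
    (IsKernelPair.of_hasPullback _) φ (hφ _ _ pullback.condition)
  refine ⟨⟨m, ?_, ?_⟩⟩
  · rw [← cancel_epi u.f₁, ← Category.assoc, ← u.inl_mapPairs, Category.assoc, hm, hl,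
      Category.comp_id]
  · rw [← cancel_epi u.f₁, ← Category.assoc, ← u.inr_mapPairs, Category.assoc, hm, hr,
      Category.comp_id]

/-- A morphism of reflexive graphs between internal groupoids, as an internal functor. -/
def toHom [Protomodular C] [HasEqualizers C] {X Y : InternalGroupoid C}
    (u : GraphHom X.toReflexiveGraph Y.toReflexiveGraph) : X ⟶ Y :=
  InternalGroupoid.homOfGraph u.f₀ u.f₁ u.w_d u.w_c u.w_e

/-- The composition of morphisms of reflexive graphs. -/
@[simps]
def comp {G H K : ReflexiveGraph C} (u : GraphHom G H) (v : GraphHom H K) : GraphHom G K where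
  f₀ := u.f₀ ≫ v.f₀
  f₁ := u.f₁ ≫ v.f₁
  w_d := by rw [Category.assoc, v.w_d, reassoc_of% u.w_d]
  w_c := by rw [Category.assoc, v.w_c, reassoc_of% u.w_c]
  w_e := by rw [reassoc_of% u.w_e, v.w_e, Category.assoc]

end GraphHom

end ReflexiveGraph

/-! ### Exactness and protomodularity of internal groupoids -/

namespace InternalGroupoid

open ReflexiveGraph

variable {C : Type u} [Category.{v} C]

/-- Composable pairs of `X` with the same image in `H` are related termwise by `R`; composing in `R`
relates their composites, which `u.f₁` then identifies. -/
lemma nonempty_multiplication_of_isKernelPair [Regular C] [Protomodular C]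
    {R X : InternalGroupoid C} (P₁ P₂ : R ⟶ X) {H : ReflexiveGraph C}
    (u : GraphHom X.toReflexiveGraph H) (h₀ : IsKernelPair u.f₀ P₁.f₀ P₂.f₀)
    (h₁ : IsKernelPair u.f₁ P₁.f₁ P₂.f₁) [IsRegularEpi u.f₁] : Nonempty H.Multiplication := by
  refine u.nonempty_multiplication (X.m ≫ u.f₁) ?_ ?_ fun {K} k₁ k₂ hk => ?_
  · rw [reassoc_of% inl_m X.toInternalCategory]
  · rw [reassoc_of% inr_m X.toInternalCategory]
  · have ha : (k₁ ≫ pullback.fst _ _) ≫ u.f₁ = (k₂ ≫ pullback.fst _ _) ≫ u.f₁ := by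
      rw [Category.assoc, ← u.mapPairs_fst, reassoc_of% hk, Category.assoc, ← u.mapPairs_fst]
    have hb : (k₁ ≫ pullback.snd _ _) ≫ u.f₁ = (k₂ ≫ pullback.snd _ _) ≫ u.f₁ := by
      rw [Category.assoc, ← u.mapPairs_snd, reassoc_of% hk, Category.assoc, ← u.mapPairs_snd]
    -- The two arrows of `R` are composable because the object parts of `P₁` and `P₂` are jointly
    -- monic.
    have hab : h₁.lift _ _ ha ≫ R.c = h₁.lift _ _ hb ≫ R.d := by
      apply h₀.hom_ext
      · rw [Category.assoc, Category.assoc, ← P₁.w_c, ← P₁.w_d, ← Category.assoc, ← Category.assoc,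
          h₁.lift_fst, h₁.lift_fst, Category.assoc, Category.assoc, pullback.condition]
      · rw [Category.assoc, Category.assoc, ← P₂.w_c, ← P₂.w_d, ← Category.assoc, ← Category.assoc,
          h₁.lift_snd, h₁.lift_snd, Category.assoc, Category.assoc, pullback.condition]
    have e₁ : k₁ ≫ X.m = (pullback.lift _ _ hab ≫ R.m) ≫ P₁.f₁ := by
      rw [Category.assoc, P₁.lift_m _ _ hab (by simp only [h₁.lift_fst, Category.assoc,
        pullback.condition])]
      congr 1
      apply pullback.hom_ext <;> simp only [pullback.lift_fst, pullback.lift_snd, h₁.lift_fst]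
    have e₂ : k₂ ≫ X.m = (pullback.lift _ _ hab ≫ R.m) ≫ P₂.f₁ := by
      rw [Category.assoc, P₂.lift_m _ _ hab (by simp only [h₁.lift_snd, Category.assoc,
        pullback.condition])]
      congr 1
      apply pullback.hom_ext <;> simp only [pullback.lift_fst, pullback.lift_snd, h₁.lift_snd]
    rw [reassoc_of% e₁, reassoc_of% e₂, h₁.w]

lemma epi_of_epi [HasPullbacks C] {X Y : InternalGroupoid C} (F : X ⟶ Y) [Epi F.f₀] [Epi F.f₁] :
    Epi F where
  left_cancellation G H h := by
    ext
    · exact (cancel_epi F.f₀).1 (congrArg InternalFunctor.f₀ h)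
    · exact (cancel_epi F.f₁).1 (congrArg InternalFunctor.f₁ h)

/-- An internal functor that is levelwise a regular epimorphism is a regular epimorphism. -/
lemma isRegularEpi_of_isKernelPair [HasFiniteLimits C] [Protomodular C] {R X Y : InternalGroupoid C}
    {P₁ P₂ : R ⟶ X} {F : X ⟶ Y} (h₀ : IsKernelPair F.f₀ P₁.f₀ P₂.f₀)
    (h₁ : IsKernelPair F.f₁ P₁.f₁ P₂.f₁) [IsRegularEpi F.f₀] [IsRegularEpi F.f₁] :
    IsRegularEpi F := by
  have := epi_of_epi F
  have key : ∀ {Z : InternalGroupoid C} (G : X ⟶ Z), P₁ ≫ G = P₂ ≫ G → ∃ H : Y ⟶ Z, F ≫ H = G := by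
    intro Z G hG
    obtain ⟨H₀, hH₀⟩ := IsRegularEpi.exists_of_isKernelPair F.f₀ h₀ G.f₀
      (congrArg InternalFunctor.f₀ hG)
    obtain ⟨H₁, hH₁⟩ := IsRegularEpi.exists_of_isKernelPair F.f₁ h₁ G.f₁
      (congrArg InternalFunctor.f₁ hG)
    refine ⟨homOfGraph H₀ H₁ ?_ ?_ ?_, hom_ext hH₀ hH₁⟩
    · rw [← cancel_epi F.f₁, reassoc_of% hH₁, G.w_d, reassoc_of% F.w_d, hH₀]
    · rw [← cancel_epi F.f₁, reassoc_of% hH₁, G.w_c, reassoc_of% F.w_c, hH₀]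
    · rw [← cancel_epi F.f₀, reassoc_of% hH₀, ← reassoc_of% F.w_e, hH₁, G.w_e]
  have w : P₁ ≫ F = P₂ ≫ F := by ext; exacts [h₀.w, h₁.w]
  refine ⟨⟨⟨R, P₁, P₂, w, Cofork.IsColimit.mk' _ fun s => ?_⟩⟩⟩
  have hs := key s.π s.condition
  exact ⟨hs.choose, hs.choose_spec, fun {m} hm => (cancel_epi F).1 (hm.trans hs.choose_spec.symm)⟩

/-- Equivalence relations of internal groupoids have levelwise effective quotients. -/
lemma exists_quotient [BarrExact C] [Protomodular C] [HasZeroObject C] {R X : InternalGroupoid C}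
    (P₁ P₂ : R ⟶ X) [IsEquivalenceRelation P₁ P₂] :
    ∃ (Y : InternalGroupoid C) (q : X ⟶ Y), IsKernelPair q P₁ P₂ ∧ IsRegularEpi q ∧
      IsRegularEpi q.f₀ ∧ IsRegularEpi q.f₁ := by
  have : IsEquivalenceRelation P₁.f₀ P₂.f₀ := IsEquivalenceRelation.map (objects C) P₁ P₂
  have : IsEquivalenceRelation P₁.f₁ P₂.f₁ := IsEquivalenceRelation.map (arrows C) P₁ P₂
  obtain ⟨Y₀, q₀, h₀, _⟩ := BarrExact.exists_quotient P₁.f₀ P₂.f₀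
  obtain ⟨Y₁, q₁, h₁, hq₁⟩ := BarrExact.exists_quotient P₁.f₁ P₂.f₁
  obtain ⟨d, hd⟩ := IsRegularEpi.exists_of_isKernelPair q₁ h₁ (X.d ≫ q₀)
    (by rw [reassoc_of% P₁.w_d, reassoc_of% P₂.w_d, h₀.w])
  obtain ⟨c, hc⟩ := IsRegularEpi.exists_of_isKernelPair q₁ h₁ (X.c ≫ q₀)
    (by rw [reassoc_of% P₁.w_c, reassoc_of% P₂.w_c, h₀.w])
  obtain ⟨e, he⟩ := IsRegularEpi.exists_of_isKernelPair q₀ h₀ (X.e ≫ q₁)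
    (by rw [← reassoc_of% P₁.w_e, ← reassoc_of% P₂.w_e, h₁.w])
  let H : ReflexiveGraph C :=
    { X₀ := Y₀
      X₁ := Y₁
      d := d
      c := c
      e := e
      e_d := by
        rw [← cancel_epi q₀, reassoc_of% he, hd, reassoc_of% X.e_d, Category.comp_id]
      e_c := by
        rw [← cancel_epi q₀, reassoc_of% he, hc, reassoc_of% X.e_c, Category.comp_id] }
  let u : GraphHom X.toReflexiveGraph H := ⟨q₀, q₁, hd, hc, he.symm⟩
  have : IsRegularEpi u.f₁ := hq₁
  obtain ⟨μ⟩ := nonempty_multiplication_of_isKernelPair P₁ P₂ u h₀ h₁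
  let Y : InternalGroupoid C := μ.toInternalGroupoid
  let q : X ⟶ Y := GraphHom.toHom (Y := Y) u
  have hq : IsKernelPair q P₁ P₂ := isPullback_of_isPullback h₀ h₁
  have hq₀ : IsRegularEpi q.f₀ := ‹IsRegularEpi q₀›
  have hq₁ : IsRegularEpi q.f₁ := hq₁
  exact ⟨Y, q, hq, isRegularEpi_of_isKernelPair h₀ h₁, hq₀, hq₁⟩

/-- The family of functors `objects C` and `arrows C`. -/
def levels (C : Type u) [Category.{v} C] [HasPullbacks C] (i : Bool) : InternalGroupoid C ⥤ C :=
  bif i then arrows C else objects C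

instance [Protomodular C] [HasFiniteLimits C] [HasZeroObject C] (i : Bool) :
    PreservesFiniteLimits (levels C i) := by
  cases i
  · exact inferInstanceAs (PreservesFiniteLimits (objects C))
  · exact inferInstanceAs (PreservesFiniteLimits (arrows C))

lemma reflectsExactness_levels [BarrExact C] [Protomodular C] [HasZeroObject C] :
    ReflectsExactness (levels C) where
  isIso_of_map F h := by
    have : IsIso F.f₀ := h false
    have : IsIso F.f₁ := h true
    exact isIso_of_isIso F
  exists_quotient P₁ P₂ _ := by
    obtain ⟨Y, q, h, hq, h₀, h₁⟩ := exists_quotient P₁ P₂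
    exact ⟨Y, q, h, hq, fun i => by cases i; exacts [h₀, h₁]⟩

instance [BarrExact C] [Protomodular C] [HasZeroObject C] : BarrExact (InternalGroupoid C) :=
  reflectsExactness_levels.barrExact

instance [BarrExact C] [Protomodular C] [HasZeroObject C] : Protomodular (InternalGroupoid C) :=
  reflectsExactness_levels.protomodular

lemma isRegularEpi_f₀ [BarrExact C] [Protomodular C] [HasZeroObject C] {X Y : InternalGroupoid C}
    (F : X ⟶ Y) [IsRegularEpi F] : IsRegularEpi F.f₀ :=
  reflectsExactness_levels.isRegularEpi_map F false

lemma isRegularEpi_f₁ [BarrExact C] [Protomodular C] [HasZeroObject C] {X Y : InternalGroupoid C}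
    (F : X ⟶ Y) [IsRegularEpi F] : IsRegularEpi F.f₁ :=
  reflectsExactness_levels.isRegularEpi_map F true

end InternalGroupoid

/-! ### Reflecting reflexive graphs in internal groupoids -/

namespace ReflexiveGraph

variable {C : Type u} [Category.{v} C] [SemiAbelian C] (G : ReflexiveGraph C)

/-- The composable pairs `(x, 1)` and `(1, x)` of a reflexive graph can be identified universally,
without changing the object of objects. -/
lemma exists_identify_inl_inr : ∃ (H : ReflexiveGraph C) (u : GraphHom G H)
    (φ : pullback G.c G.d ⟶ H.X₁), IsIso u.f₀ ∧ IsRegularEpi u.f₁ ∧ G.inl ≫ φ = u.f₁ ∧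
      G.inr ≫ φ = u.f₁ ∧ ∀ {Z : C} (ψ : pullback G.c G.d ⟶ Z), G.inl ≫ ψ = G.inr ≫ ψ →
        ∃ χ : H.X₁ ⟶ Z, φ ≫ χ = ψ := by
  let φ := coequalizer.π G.inl G.inr
  have hφ : G.inl ≫ φ = G.inr ≫ φ := coequalizer.condition _ _
  let d : coequalizer G.inl G.inr ⟶ G.X₀ := coequalizer.desc (pullback.fst _ _ ≫ G.d)
    (by rw [reassoc_of% G.inl_fst, reassoc_of% G.inr_fst, G.e_d, Category.comp_id])
  let c : coequalizer G.inl G.inr ⟶ G.X₀ := coequalizer.desc (pullback.snd _ _ ≫ G.c)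
    (by rw [reassoc_of% G.inl_snd, reassoc_of% G.inr_snd, G.e_c, Category.comp_id])
  have hd : (G.inl ≫ φ) ≫ d = G.d := by
    rw [Category.assoc, coequalizer.π_desc, reassoc_of% G.inl_fst]
  have hc : (G.inl ≫ φ) ≫ c = G.c := by
    rw [Category.assoc, coequalizer.π_desc, reassoc_of% G.inl_snd, G.e_c, Category.comp_id]
  -- If `inl ≫ φ = inr ≫ φ` factors through a subobject `j`, the preimage of `j` under `φ` contains
  -- `inl` and `inr`, hence is everything. So `φ` factors through `j`, which is invertible as `φ` is
  -- extremal.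
  have : ExtremalEpi (G.inl ≫ φ) := .mk_of_hasEqualizers _ fun Z p j hp _ => by
    have := G.isIso_of_mono (pullback.fst φ j) (pullback.lift_fst _ _ hp.symm)
      (pullback.lift_fst _ _ (hφ.symm.trans hp.symm))
    exact ExtremalEpi.isIso φ (inv (pullback.fst φ j) ≫ pullback.snd _ _) j
      (by rw [Category.assoc, ← pullback.condition, IsIso.inv_hom_id_assoc])
  exact ⟨⟨G.X₀, coequalizer G.inl G.inr, d, c, G.e ≫ G.inl ≫ φ,
    by rw [Category.assoc, hd, G.e_d], by rw [Category.assoc, hc, G.e_c]⟩,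
    ⟨𝟙 _, G.inl ≫ φ, hd.trans (Category.comp_id _).symm, hc.trans (Category.comp_id _).symm,
      (Category.id_comp _).symm⟩, φ, (inferInstance : IsIso (𝟙 G.X₀)),
    (inferInstance : IsRegularEpi (G.inl ≫ φ)), rfl, hφ.symm,
    fun ψ hψ => ⟨coequalizer.desc ψ hψ, coequalizer.π_desc _ _⟩⟩

-- As `u.f₀` is invertible, arrows identified by `u.f₁` are parallel, so its kernel pair is a
-- reflexive graph `N` on the same objects, projecting to `G` by `u₁` and `u₂`. The two maps
-- `mapPairs ≫ φ` from pairs of `N` agree on `inl` and `inr`, hence everywhere. So `φ` is compatible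
-- with the kernel pair of `u.mapPairs`, without any multiplication on `G`.
variable {G} in
lemma GraphHom.nonempty_multiplication_of_isIso {H : ReflexiveGraph C} (u : GraphHom G H)
    [IsIso u.f₀] [IsRegularEpi u.f₁] (φ : pullback G.c G.d ⟶ H.X₁) (hl : G.inl ≫ φ = u.f₁)
    (hr : G.inr ≫ φ = u.f₁) : Nonempty H.Multiplication := by
  refine u.nonempty_multiplication φ hl hr fun {K} k₁ k₂ hk => ?_
  let n₁ := pullback.fst u.f₁ u.f₁
  let n₂ := pullback.snd u.f₁ u.f₁
  have hn : n₁ ≫ u.f₁ = n₂ ≫ u.f₁ := pullback.condition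
  have hd : n₁ ≫ G.d = n₂ ≫ G.d := by
    rw [← cancel_mono u.f₀, Category.assoc, Category.assoc, ← u.w_d, reassoc_of% hn]
  have hc : n₁ ≫ G.c = n₂ ≫ G.c := by
    rw [← cancel_mono u.f₀, Category.assoc, Category.assoc, ← u.w_c, reassoc_of% hn]
  let N : ReflexiveGraph C :=
    { X₀ := G.X₀
      X₁ := pullback u.f₁ u.f₁
      d := n₁ ≫ G.d
      c := n₁ ≫ G.c
      e := pullback.lift G.e G.e rfl
      e_d := by rw [pullback.lift_fst_assoc, G.e_d]
      e_c := by rw [pullback.lift_fst_assoc, G.e_c] }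
  let u₁ : GraphHom N G := ⟨𝟙 _, n₁, (Category.comp_id _).symm, (Category.comp_id _).symm,
    (pullback.lift_fst _ _ _).trans (Category.id_comp _).symm⟩
  let u₂ : GraphHom N G := ⟨𝟙 _, n₂, hd.symm.trans (Category.comp_id _).symm,
    hc.symm.trans (Category.comp_id _).symm, (pullback.lift_snd _ _ _).trans
      (Category.id_comp _).symm⟩
  have key : u₁.mapPairs ≫ φ = u₂.mapPairs ≫ φ := by
    apply ReflexiveGraph.hom_ext
    · rw [← Category.assoc, u₁.inl_mapPairs, ← Category.assoc, u₂.inl_mapPairs, Category.assoc,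
        Category.assoc, hl]
      exact hn
    · rw [← Category.assoc, u₁.inr_mapPairs, ← Category.assoc, u₂.inr_mapPairs, Category.assoc,
        Category.assoc, hr]
      exact hn
  have ha : (k₁ ≫ pullback.fst _ _) ≫ u.f₁ = (k₂ ≫ pullback.fst _ _) ≫ u.f₁ := by
    have := hk =≫ pullback.fst _ _
    simpa only [Category.assoc, GraphHom.mapPairs_fst] using this
  have hb : (k₁ ≫ pullback.snd _ _) ≫ u.f₁ = (k₂ ≫ pullback.snd _ _) ≫ u.f₁ := by
    have := hk =≫ pullback.snd _ _
    simpa only [Category.assoc, GraphHom.mapPairs_snd] using this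
  let l : K ⟶ pullback N.c N.d := pullback.lift (pullback.lift _ _ ha) (pullback.lift _ _ hb) (by
    simp only [N, n₁, pullback.lift_fst_assoc, Category.assoc, pullback.condition])
  have h₁ : k₁ = l ≫ u₁.mapPairs := by
    apply pullback.hom_ext
    · rw [Category.assoc, u₁.mapPairs_fst, pullback.lift_fst_assoc]
      exact (pullback.lift_fst _ _ _).symm
    · rw [Category.assoc, u₁.mapPairs_snd, pullback.lift_snd_assoc]
      exact (pullback.lift_fst _ _ _).symm
  have h₂ : k₂ = l ≫ u₂.mapPairs := by
    apply pullback.hom_ext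
    · rw [Category.assoc, u₂.mapPairs_fst, pullback.lift_fst_assoc]
      exact (pullback.lift_snd _ _ _).symm
    · rw [Category.assoc, u₂.mapPairs_snd, pullback.lift_snd_assoc]
      exact (pullback.lift_snd _ _ _).symm
  rw [h₁, h₂, Category.assoc, key, Category.assoc]

/-- The category of internal groupoids is reflective in that of reflexive graphs, with a reflection
that does not change the object of objects. -/
lemma exists_reflection : ∃ (Q : InternalGroupoid C) (u : GraphHom G Q.toReflexiveGraph),
    IsIso u.f₀ ∧ Epi u.f₁ ∧ ∀ (Z : InternalGroupoid C) (h : GraphHom G Z.toReflexiveGraph),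
      ∃ k : Q ⟶ Z, u.f₀ ≫ k.f₀ = h.f₀ ∧ u.f₁ ≫ k.f₁ = h.f₁ := by
  obtain ⟨H, u, φ, _, _, hl, hr, hφ⟩ := G.exists_identify_inl_inr
  obtain ⟨μ⟩ := u.nonempty_multiplication_of_isIso φ hl hr
  obtain ⟨Q, rfl⟩ : ∃ Q : InternalGroupoid C, Q.toReflexiveGraph = H := ⟨μ.toInternalGroupoid, rfl⟩
  refine ⟨Q, u, inferInstance, inferInstance, fun Z h => ?_⟩
  -- The map `(x, y) ↦ h(x) h(y)` restricts to `h.f₁` on both `inl` and `inr`, so it factors through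
  -- `φ`.
  have hm : G.inl ≫ h.mapPairs ≫ Z.m = h.f₁ := by
    rw [← Category.assoc, h.inl_mapPairs, Category.assoc, InternalGroupoid.inl_m, Category.comp_id]
  have hm' : G.inr ≫ h.mapPairs ≫ Z.m = h.f₁ := by
    rw [← Category.assoc, h.inr_mapPairs, Category.assoc, InternalGroupoid.inr_m, Category.comp_id]
  obtain ⟨k₁, hk₁⟩ := hφ (h.mapPairs ≫ Z.m) (hm.trans hm'.symm)
  have hk : u.f₁ ≫ k₁ = h.f₁ := by rw [← hl, Category.assoc, hk₁, hm]
  refine ⟨InternalGroupoid.homOfGraph (inv u.f₀ ≫ h.f₀) k₁ ?_ ?_ ?_,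
    IsIso.hom_inv_id_assoc _ _, hk⟩
  · rw [← cancel_epi u.f₁, reassoc_of% hk, h.w_d, reassoc_of% u.w_d, IsIso.hom_inv_id_assoc]
  · rw [← cancel_epi u.f₁, reassoc_of% hk, h.w_c, reassoc_of% u.w_c, IsIso.hom_inv_id_assoc]
  · rw [← cancel_epi u.f₀, ← reassoc_of% u.w_e, hk, h.w_e, Category.assoc,
      IsIso.hom_inv_id_assoc]

end ReflexiveGraph

/-! ### Coproducts of internal groupoids -/

namespace InternalGroupoid

open ReflexiveGraph

variable {C : Type u} [Category.{v} C] [SemiAbelian C]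

/-- Reflexive graphs have levelwise coproducts, and the reflection carries them to groupoids.
Uniqueness holds because both components of the unit `u` are epimorphisms. -/
lemma exists_coproduct (X Y : InternalGroupoid C) : ∃ (Q : InternalGroupoid C) (a : X ⟶ Q)
    (b : Y ⟶ Q), Nonempty (IsColimit (BinaryCofan.mk a b)) := by
  let G : ReflexiveGraph C :=
    { X₀ := X.X₀ ⨿ Y.X₀
      X₁ := X.X₁ ⨿ Y.X₁
      d := coprod.map X.d Y.d
      c := coprod.map X.c Y.c
      e := coprod.map X.e Y.e
      e_d := by rw [coprod.map_map, X.e_d, Y.e_d, coprod.map_id_id]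
      e_c := by rw [coprod.map_map, X.e_c, Y.e_c, coprod.map_id_id] }
  let iX : GraphHom X.toReflexiveGraph G := ⟨coprod.inl, coprod.inl, coprod.inl_map _ _,
    coprod.inl_map _ _, (coprod.inl_map _ _).symm⟩
  let iY : GraphHom Y.toReflexiveGraph G := ⟨coprod.inr, coprod.inr, coprod.inr_map _ _,
    coprod.inr_map _ _, (coprod.inr_map _ _).symm⟩
  obtain ⟨Q, u, _, _, hQ⟩ := G.exists_reflection
  let a : X ⟶ Q := GraphHom.toHom (iX.comp u)
  let b : Y ⟶ Q := GraphHom.toHom (iY.comp u)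
  have key : ∀ {Z : InternalGroupoid C} (f : X ⟶ Z) (g : Y ⟶ Z),
      ∃ k : Q ⟶ Z, a ≫ k = f ∧ b ≫ k = g := by
    intro Z f g
    obtain ⟨k, hk₀, hk₁⟩ := hQ Z
      { f₀ := coprod.desc f.f₀ g.f₀
        f₁ := coprod.desc f.f₁ g.f₁
        w_d := by rw [coprod.desc_comp, coprod.map_desc, f.w_d, g.w_d]
        w_c := by rw [coprod.desc_comp, coprod.map_desc, f.w_c, g.w_c]
        w_e := by rw [coprod.desc_comp, coprod.map_desc, f.w_e, g.w_e] }
    refine ⟨k, hom_ext ?_ ?_, hom_ext ?_ ?_⟩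
    · exact (Category.assoc _ _ _).trans ((coprod.inl ≫= hk₀).trans (coprod.inl_desc _ _))
    · exact (Category.assoc _ _ _).trans ((coprod.inl ≫= hk₁).trans (coprod.inl_desc _ _))
    · exact (Category.assoc _ _ _).trans ((coprod.inr ≫= hk₀).trans (coprod.inr_desc _ _))
    · exact (Category.assoc _ _ _).trans ((coprod.inr ≫= hk₁).trans (coprod.inr_desc _ _))
  refine ⟨Q, a, b, ⟨BinaryCofan.isColimitMk (fun s => (key s.inl s.inr).choose)
    (fun s => (key s.inl s.inr).choose_spec.1) (fun s => (key s.inl s.inr).choose_spec.2)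
    fun s m h₁ h₂ => ?_⟩⟩
  have h₁' := h₁.trans (key s.inl s.inr).choose_spec.1.symm
  have h₂' := h₂.trans (key s.inl s.inr).choose_spec.2.symm
  apply hom_ext
  · refine (cancel_epi u.f₀).1 (coprod.hom_ext ?_ ?_)
    · exact (Category.assoc _ _ _).symm.trans
        ((congrArg InternalFunctor.f₀ h₁').trans (Category.assoc _ _ _))
    · exact (Category.assoc _ _ _).symm.trans
        ((congrArg InternalFunctor.f₀ h₂').trans (Category.assoc _ _ _))
  · refine (cancel_epi u.f₁).1 (coprod.hom_ext ?_ ?_)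
    · exact (Category.assoc _ _ _).symm.trans
        ((congrArg InternalFunctor.f₁ h₁').trans (Category.assoc _ _ _))
    · exact (Category.assoc _ _ _).symm.trans
        ((congrArg InternalFunctor.f₁ h₂').trans (Category.assoc _ _ _))

instance : HasBinaryCoproducts (InternalGroupoid C) :=
  have (X Y : InternalGroupoid C) : HasColimit (pair X Y) := by
    obtain ⟨Q, a, b, ⟨h⟩⟩ := exists_coproduct X Y
    exact ⟨⟨⟨_, h⟩⟩⟩
  hasBinaryCoproducts_of_hasColimit_pair _

/-- The category of internal groupoids in a semi-abelian category is semi-abelian. -/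
instance : SemiAbelian (InternalGroupoid C) where

end InternalGroupoid

/-! ### Full subcategories of semi-abelian categories -/

/-- A reflective full subcategory of a semi-abelian category that is closed under finite limits and
regular quotients is semi-abelian. -/
lemma SemiAbelian.fullSubcategory {D : Type u} [Category.{v} D] [SemiAbelian D]
    (P : ObjectProperty D)
    (hlim : ∀ (J : Type) [SmallCategory J] [FinCategory J], P.IsClosedUnderLimitsOfShape J)
    (hzero : ∃ Z : D, IsZero Z ∧ P Z)
    (hquot : ∀ {X Y : D} (q : X ⟶ Y) [IsRegularEpi q], P X → P Y)
    (hrefl : ∀ X : D, ∃ (Q : D) (r : X ⟶ Q), P Q ∧ Epi r ∧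
      ∀ {Z : D}, P Z → ∀ f : X ⟶ Z, ∃ k : Q ⟶ Z, r ≫ k = f) :
    SemiAbelian P.FullSubcategory := by
  have : HasFiniteLimits P.FullSubcategory := ⟨fun J _ _ => inferInstance⟩
  have : PreservesFiniteLimits P.ι := ⟨fun J _ _ => inferInstance⟩
  have hP : ReflectsExactness (fun _ : Unit => P.ι) :=
    { isIso_of_map := fun f h => (P.isIso_hom_iff f).1 (h ())
      exists_quotient := fun {R X} p₁ p₂ _ => by
        have : IsEquivalenceRelation p₁.hom p₂.hom := IsEquivalenceRelation.map P.ι p₁ p₂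
        obtain ⟨Y, q, hq, _⟩ := BarrExact.exists_quotient p₁.hom p₂.hom
        let Y' : P.FullSubcategory := ⟨Y, hquot q X.property⟩
        let q' : X ⟶ Y' := P.homMk q
        have hq' : IsKernelPair q' p₁ p₂ := IsPullback.of_map_of_faithful P.ι hq
        have : Epi q' := ⟨fun a b h => P.hom_ext ((cancel_epi q).1 (congrArg (·.hom) h))⟩
        refine ⟨Y', q', hq', ⟨⟨⟨R, p₁, p₂, hq'.w, Cofork.IsColimit.mk' _ fun s => ?_⟩⟩⟩,
          fun _ => (inferInstance : IsRegularEpi q)⟩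
        have hs := IsRegularEpi.exists_of_isKernelPair q hq s.π.hom (congrArg (·.hom) s.condition)
        exact ⟨P.homMk hs.choose, P.hom_ext hs.choose_spec, fun {m} hm => (cancel_epi q').1
          (hm.trans (P.hom_ext hs.choose_spec.symm))⟩ }
  have : BarrExact P.FullSubcategory := hP.barrExact
  have : Protomodular P.FullSubcategory := hP.protomodular
  have : HasZeroObject P.FullSubcategory := by
    obtain ⟨Z, hZ, hPZ⟩ := hzero
    exact ⟨⟨Z, hPZ⟩, (IsZero.of_full_of_faithful_of_isZero P.ι _ hZ)⟩
  have : HasBinaryCoproducts P.FullSubcategory := by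
    have (X Y : P.FullSubcategory) : HasColimit (pair X Y) := by
      obtain ⟨Q, r, hQ, hr, hk⟩ := hrefl (X.obj ⨿ Y.obj)
      let a : X ⟶ ⟨Q, hQ⟩ := P.homMk (coprod.inl ≫ r)
      let b : Y ⟶ ⟨Q, hQ⟩ := P.homMk (coprod.inr ≫ r)
      have key (s : BinaryCofan X Y) := hk s.pt.property (coprod.desc s.inl.hom s.inr.hom)
      refine ⟨⟨⟨BinaryCofan.mk a b, BinaryCofan.isColimitMk
        (fun s => P.homMk (key s).choose) (fun s => P.hom_ext ?_) (fun s => P.hom_ext ?_)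
        fun s m h₁ h₂ => P.hom_ext ((cancel_epi r).1 (coprod.hom_ext ?_ ?_))⟩⟩⟩
      · exact (Category.assoc _ _ _).trans
          ((coprod.inl ≫= (key s).choose_spec).trans (coprod.inl_desc _ _))
      · exact (Category.assoc _ _ _).trans
          ((coprod.inr ≫= (key s).choose_spec).trans (coprod.inr_desc _ _))
      · exact (Category.assoc _ _ _).symm.trans ((congrArg (·.hom) h₁).trans
          ((coprod.inl ≫= (key s).choose_spec).trans (coprod.inl_desc _ _)).symm)
      · exact (Category.assoc _ _ _).symm.trans ((congrArg (·.hom) h₂).trans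
          ((coprod.inr ≫= (key s).choose_spec).trans (coprod.inr_desc _ _)).symm)
    exact hasBinaryCoproducts_of_hasColimit_pair _
  exact {}

/-! ### The subcategory of 2-groupoids -/

namespace InternalGroupoid

open ReflexiveGraph

section

variable {C : Type u} [Category.{v} C]

/-- A split epimorphism that is monic is invertible. Discreteness thus becomes monicity of `d`,
which is easily tested on limits. -/
lemma isIso_e_of_mono [HasPullbacks C] (X : InternalGroupoid C) [Mono X.d] : IsIso X.e :=
  ⟨X.d, X.e_d, by rw [← cancel_mono X.d, Category.assoc, X.e_d, Category.comp_id, Category.id_comp]⟩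

lemma mono_d_of_isIso [HasPullbacks C] (X : InternalGroupoid C) [IsIso X.e] : Mono X.d := by
  have : X.d = inv X.e := IsIso.eq_inv_of_hom_inv_id X.e_d
  rw [this]
  infer_instance

end

variable {C : Type u} [Category.{v} C] [SemiAbelian C]

/-- The reflection of internal groupoids in discrete ones. -/
lemma exists_discrete_reflection (X : InternalGroupoid C) :
    ∃ (A : InternalGroupoid C) (p : X ⟶ A), IsIso A.e ∧ Epi p ∧
      ∀ {Z : InternalGroupoid C} [IsIso Z.e] (f : X ⟶ Z), ∃ g : A ⟶ Z, p ≫ g = f := by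
  -- The coequalizer of `d` and `c` is the object of connected components.
  let q := coequalizer.π X.d X.c
  have hq : X.d ≫ q = X.c ≫ q := coequalizer.condition _ _
  have hq' : X.e ≫ X.d ≫ q = q := by rw [reassoc_of% X.e_d]
  let A := discrete (coequalizer X.d X.c)
  let p : X ⟶ A := homOfGraph q (X.d ≫ q) (Category.comp_id _) ((Category.comp_id _).trans hq)
    (hq'.trans (Category.comp_id _).symm)
  have h₀ : Epi q := inferInstance
  have h₁ : Epi (X.d ≫ q) := epi_of_epi_fac hq'
  have : Epi p.f₀ := h₀
  have : Epi p.f₁ := h₁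
  refine ⟨A, p, inferInstanceAs (IsIso (𝟙 (coequalizer X.d X.c))), epi_of_epi p, fun {Z} _ f => ?_⟩
  have hd : Z.d = inv Z.e := IsIso.eq_inv_of_hom_inv_id Z.e_d
  have hc : Z.c = inv Z.e := IsIso.eq_inv_of_hom_inv_id Z.e_c
  have hf : f.f₁ = X.d ≫ f.f₀ ≫ Z.e := by
    rw [← reassoc_of% f.w_d, hd, IsIso.inv_hom_id, Category.comp_id]
  have hf' : X.d ≫ f.f₀ = X.c ≫ f.f₀ := by rw [← f.w_d, ← f.w_c, hd, hc]
  let g : coequalizer X.d X.c ⟶ Z.X₀ := coequalizer.desc f.f₀ hf'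
  have hg : q ≫ g = f.f₀ := coequalizer.π_desc _ _
  refine ⟨homOfGraph g (g ≫ Z.e) ?_ ?_ ?_, hom_ext hg ?_⟩
  · exact (Category.assoc _ _ _).trans ((g ≫= Z.e_d).trans
      ((Category.comp_id _).trans (Category.id_comp _).symm))
  · exact (Category.assoc _ _ _).trans ((g ≫= Z.e_c).trans
      ((Category.comp_id _).trans (Category.id_comp _).symm))
  · exact Category.id_comp _
  · refine Eq.trans ?_ hf.symm
    change (X.d ≫ q) ≫ g ≫ Z.e = _
    rw [Category.assoc, reassoc_of% hg]

/-- Internal groupoids can be pushed forward along a morphism from the object of objects. -/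
lemma exists_pushforward (X : InternalGroupoid C) {A : C} (p : X.X₀ ⟶ A) [Epi p] :
    ∃ (Q : InternalGroupoid C) (r : X ⟶ Q) (v : A ⟶ Q.X₀), IsIso v ∧ Epi r ∧
      ∀ {Z : InternalGroupoid C} (f : X ⟶ Z) (g : A ⟶ Z.X₀), p ≫ g = f.f₀ →
        ∃ k : Q ⟶ Z, r ≫ k = f := by
  have hp : X.e ≫ pushout.inl X.e p = p ≫ pushout.inr X.e p := pushout.condition
  -- The pushout of `e` along `p` is the object of arrows of the universal reflexive graph on `A`
  -- under `X`: the leg from `A` supplies the identities.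
  let d : pushout X.e p ⟶ A := pushout.desc (X.d ≫ p) (𝟙 _)
    (by rw [reassoc_of% X.e_d, Category.comp_id])
  let c : pushout X.e p ⟶ A := pushout.desc (X.c ≫ p) (𝟙 _)
    (by rw [reassoc_of% X.e_c, Category.comp_id])
  let G : ReflexiveGraph C := ⟨A, pushout X.e p, d, c, pushout.inr _ _, pushout.inr_desc _ _ _,
    pushout.inr_desc _ _ _⟩
  let i : GraphHom X.toReflexiveGraph G := ⟨p, pushout.inl _ _, pushout.inl_desc _ _ _,
    pushout.inl_desc _ _ _, hp⟩
  obtain ⟨Q, u, _, _, hQ⟩ := G.exists_reflection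
  let r : X ⟶ Q := GraphHom.toHom (i.comp u)
  refine ⟨Q, r, u.f₀, inferInstance, ⟨fun {Z} k k' h => ?_⟩, fun {Z} f g hg => ?_⟩
  · have h₀ : u.f₀ ≫ k.f₀ = u.f₀ ≫ k'.f₀ := by
      rw [← cancel_epi p, ← Category.assoc, ← Category.assoc]
      exact congrArg InternalFunctor.f₀ h
    apply hom_ext
    · rwa [cancel_epi] at h₀
    · refine (cancel_epi u.f₁).1 (pushout.hom_ext ?_ ?_)
      · exact (Category.assoc _ _ _).symm.trans
          ((congrArg InternalFunctor.f₁ h).trans (Category.assoc _ _ _))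
      -- On the leg from `A` the arrows are identities, so functors agreeing on objects agree there.
      · change G.e ≫ u.f₁ ≫ k.f₁ = G.e ≫ u.f₁ ≫ k'.f₁
        rw [reassoc_of% u.w_e, reassoc_of% u.w_e, k.w_e, k'.w_e, reassoc_of% h₀]
  · let b : pushout X.e p ⟶ Z.X₁ := pushout.desc f.f₁ (g ≫ Z.e) (by rw [f.w_e, reassoc_of% hg])
    have hb : pushout.inl _ _ ≫ b = f.f₁ := pushout.inl_desc _ _ _
    have hb' : pushout.inr _ _ ≫ b = g ≫ Z.e := pushout.inr_desc _ _ _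
    have hd : b ≫ Z.d = d ≫ g := by
      apply pushout.hom_ext
      · rw [reassoc_of% hb, f.w_d, pushout.inl_desc_assoc, Category.assoc, hg]
      · rw [reassoc_of% hb', Z.e_d, Category.comp_id, pushout.inr_desc_assoc, Category.id_comp]
    have hc : b ≫ Z.c = c ≫ g := by
      apply pushout.hom_ext
      · rw [reassoc_of% hb, f.w_c, pushout.inl_desc_assoc, Category.assoc, hg]
      · rw [reassoc_of% hb', Z.e_c, Category.comp_id, pushout.inr_desc_assoc, Category.id_comp]
    obtain ⟨k, hk₀, hk₁⟩ := hQ Z ⟨g, b, hd, hc, hb'⟩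
    exact ⟨k, hom_ext ((Category.assoc _ _ _).trans ((p ≫= hk₀).trans hg))
      ((Category.assoc _ _ _).trans ((pushout.inl _ _ ≫= hk₁).trans hb))⟩

/-- A functor from `X` to a 2-groupoid factors on objects through the discrete reflection of `X.X₀`,
hence through the pushforward of `X` along it. The latter is a 2-groupoid, its groupoid of objects
being isomorphic to that reflection. -/
lemma exists_twoGroupoid_reflection (X : InternalDoubleGroupoid C) :
    ∃ (Q : InternalDoubleGroupoid C) (r : X ⟶ Q), isInternalTwoGroupoid C Q ∧ Epi r ∧
      ∀ {Z : InternalDoubleGroupoid C}, isInternalTwoGroupoid C Z →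
        ∀ f : X ⟶ Z, ∃ k : Q ⟶ Z, r ≫ k = f := by
  obtain ⟨A, p, _, _, hA⟩ := exists_discrete_reflection X.X₀
  obtain ⟨Q, r, v, _, _, hQ⟩ := exists_pushforward X p
  refine ⟨Q, r, ?_, inferInstance, fun {Z} hZ f => ?_⟩
  · have : IsIso v.f₀ := inferInstanceAs (IsIso ((objects C).map v))
    have : IsIso v.f₁ := inferInstanceAs (IsIso ((arrows C).map v))
    have h : Q.X₀.e = inv v.f₀ ≫ A.e ≫ v.f₁ := by rw [v.w_e, IsIso.inv_hom_id_assoc]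
    change IsIso Q.X₀.e
    rw [h]
    infer_instance
  · have : IsIso Z.X₀.e := hZ
    obtain ⟨g, hg⟩ := hA f.f₀
    exact hQ f g hg

/-- The functor `X ↦ X.X₀.X₁` preserves finite limits, so the limit projections are jointly monic at
that level; by naturality of `d`, its monicity on each term of the diagram gives it on the limit. -/
lemma isClosedUnderLimitsOfShape_isInternalTwoGroupoid (J : Type) [SmallCategory J]
    [FinCategory J] : (isInternalTwoGroupoid C).IsClosedUnderLimitsOfShape J where
  limitsOfShape_le := by
    rintro X ⟨h⟩
    have : Mono X.X₀.d := ⟨fun {T} a b hab => by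
      refine (isLimitOfPreserves (objects (InternalGroupoid C) ⋙ arrows C) h.isLimit).hom_ext
        fun j => ?_
      have : IsIso (h.diag.obj j).X₀.e := h.prop_diag_obj j
      have := mono_d_of_isIso (h.diag.obj j).X₀
      have hw : (h.π.app j).f₀.f₁ ≫ (h.diag.obj j).X₀.d = X.X₀.d ≫ (h.π.app j).f₀.f₀ :=
        InternalFunctor.w_d _
      change a ≫ (h.π.app j).f₀.f₁ = b ≫ (h.π.app j).f₀.f₁
      rw [← cancel_mono (h.diag.obj j).X₀.d, Category.assoc, Category.assoc, hw,
        reassoc_of% hab]⟩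
    exact isIso_e_of_mono X.X₀

/-- The morphism `Y.X₀.e` is split monic, so strong epimorphy suffices. Composed with `q.f₀.f₀` it
equals `X.X₀.e ≫ q.f₀.f₁`, an isomorphism followed by a regular epimorphism. -/
lemma isInternalTwoGroupoid_of_isRegularEpi {X Y : InternalDoubleGroupoid C} (q : X ⟶ Y)
    [IsRegularEpi q] (hX : isInternalTwoGroupoid C X) : isInternalTwoGroupoid C Y := by
  have : IsIso X.X₀.e := hX
  have := isRegularEpi_f₀ q
  have := isRegularEpi_f₀ q.f₀
  have := isRegularEpi_f₁ q.f₀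
  have : StrongEpi (q.f₀.f₀ ≫ Y.X₀.e) := by
    rw [← q.f₀.w_e]
    infer_instance
  have : StrongEpi Y.X₀.e := strongEpi_of_strongEpi q.f₀.f₀ _
  have : Mono Y.X₀.e := mono_of_mono_fac Y.X₀.e_d
  exact isIso_of_mono_of_strongEpi Y.X₀.e

lemma exists_isZero_isInternalTwoGroupoid :
    ∃ Z : InternalDoubleGroupoid C, IsZero Z ∧ isInternalTwoGroupoid C Z := by
  obtain ⟨Z, hZ, hZ₀, -⟩ := exists_isZero (C := InternalGroupoid C)
  obtain ⟨W, hW, hW₀, hW₁⟩ := exists_isZero (C := C)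
  have h₀ : IsZero Z.X₀.X₀ := hW₀.of_iso ((objects C).mapIso (hZ₀.iso hW))
  have h₁ : IsZero Z.X₀.X₁ := hW₁.of_iso ((arrows C).mapIso (hZ₀.iso hW))
  exact ⟨Z, hZ, isIso_of_isInitial h₀.isInitial h₁.isInitial _⟩

end InternalGroupoid

end CategoryTheory

theorem mainTheorem4 (C : Type u) [Category.{v} C] [SemiAbelian C] :
    SemiAbelian (InternalTwoGroupoid C) :=
  SemiAbelian.fullSubcategory _
    (fun J _ _ => InternalGroupoid.isClosedUnderLimitsOfShape_isInternalTwoGroupoid J)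
    InternalGroupoid.exists_isZero_isInternalTwoGroupoid
    (fun q _ => InternalGroupoid.isInternalTwoGroupoid_of_isRegularEpi q)
    InternalGroupoid.exists_twoGroupoid_reflection
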